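/- Let $\mathbb{K}=\mathbb{R}$ or $\mathbb{C}$, let $p\ge 4$, and let $\mathfrak g$ be a $2p$-dimensional Lie algebra over $\mathbb{K}$ with lower central series $C^0(\mathfrak g)=\mathfrak g$, $C^{j}(\mathfrak g)=[\mathfrak g,C^{j-1}(\mathfrak g)]$. Assume that - $\mathfrak g$ is $2$-step nilpotent: $C^2(\mathfrak g)=0$ and $C^1(\mathfrak g)\neq 0$; - $\mathfrak g$ is symplectic: there is a nondegenerate alternating bilinear form $\theta$ on $\mathfrak g$ with $\theta([X,Y],Z)-\theta([X,Z],Y)+\theta([Y,Z],X)=0$ for all $X,Y,Z\in\mathfrak g$; - the characteristic sequence of $\mathfrak g$ is $(2,2,1,\dots,1)$ (with $2p-4$ ones), where the characteristic sequence is the maximum, in lexicographic order, over all $X\in\mathfrak g\setminus C^1(\mathfrak g)$, of the decreasing sequence of the dimensions of the Jordan blocks of the nilpotent operator $\operatorname{ad}X$. Then $\mathfrak g$ is decomposable, i.e. it is the direct sum of two nonzero ideals, and it is isomorphic to one of $$\mathfrak n_7^{124}\oplus\mathbb K^{2p-7},\quad \mathfrak n_6^{19}\oplus\mathbb K^{2p-6},\quad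 \mathfrak n_6^{20}\oplus\mathbb K^{2p-6},\quad \mathfrak n_5^{5}\oplus\mathbb K^{2p-5},\quad \mathfrak n_3^{1}\oplus\mathfrak n_3^{1}\oplus\mathbb K^{2p-6},$$ or, when $\mathbb K=\mathbb R$, to one of these or to $\mathfrak n_6^{20,1}\oplus\mathbb R^{2p-6}$. Here $\mathbb K^m$ is the abelian Lie algebra of dimension $m$, $\oplus$ is the direct product of Lie algebras, and $\mathfrak n_n^{\ast}$ is the $n$-dimensional Lie algebra with the following Maurer–Cartan equations in the basis dual to $\alpha_1,\dots,\alpha_n$ (with $d\alpha(X,Y)=\alpha([X,Y])$, and $d\alpha_i=0$ for every $i$ not mentioned): - $\mathfrak n_7^{124}$: $d\alpha_3=\alpha_1\wedge\alpha_2+\alpha_4\wedge\alpha_7$, $d\alpha_5=\alpha_1\wedge\alpha_4+\alpha_6\wedge\alpha_7$; - $\mathfrak n_6^{19}$: $d\alpha_3=\alpha_1\wedge\alpha_2$, $d\alpha_5=\alpha_1\wedge\alpha_4+\alpha_2\wedge\alpha_6$; - $\mathfrak n_6^{20}$: $d\alpha_3=\alpha_1\wedge\alpha_2$, $d\alpha_5=\alpha_1\wedge\alpha_4$,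 $d\alpha_6=\alpha_2\wedge\alpha_4$; - $\mathfrak n_6^{20,1}$: $d\alpha_3=\alpha_1\wedge\alpha_2+\alpha_4\wedge\alpha_6$, $d\alpha_5=\alpha_1\wedge\alpha_4-\alpha_2\wedge\alpha_6$; - $\mathfrak n_5^{5}$: $d\alpha_3=\alpha_1\wedge\alpha_2$, $d\alpha_5=\alpha_1\wedge\alpha_4$; - $\mathfrak n_3^{1}$: $d\alpha_3=\alpha_1\wedge\alpha_2$. -/

import Mathlib

namespace SymplecticTwoStep

/-! ### Symplectic forms, 2-step nilpotency, decomposability -/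

section General

variable (K : Type*) [Field K] (L : Type*) [LieRing L] [LieAlgebra K L]

/-- A symplectic form on a Lie algebra: an alternating bilinear form which is nondegenerate and
closed, where `dθ(X, Y, Z) = θ([X, Y], Z) - θ([X, Z], Y) + θ([Y, Z], X)`. -/
structure IsSymplecticForm (θ : LinearMap.BilinForm K L) : Prop where
  alt : θ.IsAlt
  closed : ∀ x y z : L, θ ⁅x, y⁆ z - θ ⁅x, z⁆ y + θ ⁅y, z⁆ x = 0
  nondegenerate : θ.Nondegenerate

/-- The Lie algebra admits a symplectic form. -/
def IsSymplectic : Prop := ∃ θ : LinearMap.BilinForm K L, IsSymplecticForm K L θ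

/-- The Lie algebra is 2-step nilpotent, i.e. nilpotent of nilindex exactly 2:
`C²(L) = 0` and `C¹(L) ≠ 0` for the lower central series `C⁰(L) = L`, `Cʲ(L) = [L, Cʲ⁻¹(L)]`. -/
def IsTwoStepNilpotent : Prop :=
  LieModule.lowerCentralSeries K L L 2 = ⊥ ∧ LieModule.lowerCentralSeries K L L 1 ≠ ⊥

/-- The Lie algebra is the direct sum of two nonzero ideals. -/
def IsDecomposable : Prop :=
  ∃ I J : LieIdeal K L, I ≠ ⊥ ∧ J ≠ ⊥ ∧ IsCompl I J

end General

/-! ### The characteristic sequence -/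

section CharacteristicSequence

variable {K : Type*} [Field K]

/-- `l` is the decreasing sequence of the dimensions of the Jordan blocks of the nilpotent
endomorphism `T`: there is a basis `e i j`, where `i` runs over the positions in `l` and
`0 ≤ j < l i`, with `T (e i j) = e i (j + 1)` if `j + 1 < l i`, and `T (e i j) = 0` otherwise. -/
def HasJordanBlocks {V : Type*} [AddCommGroup V] [Module K V] (T : Module.End K V)
    (l : List ℕ) : Prop :=
  l.Pairwise (fun a b => b ≤ a) ∧ (∀ a ∈ l, 0 < a) ∧
    ∃ e : Module.Basis (Σ i : Fin l.length, Fin (l.get i)) K V,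
      ∀ (i : Fin l.length) (j : Fin (l.get i)),
        T (e ⟨i, j⟩) = if h : (j : ℕ) + 1 < l.get i then e ⟨i, ⟨(j : ℕ) + 1, h⟩⟩ else 0

variable (K)

/-- `c` is the characteristic sequence of the nilpotent Lie algebra `L`: the maximum, for the
lexicographic order (which is the order of `List ℕ`), of the Jordan block sequences of `ad X`
over all `X` in `L` outside `C¹(L)`. -/
def IsCharacteristicSequence (L : Type*) [LieRing L] [LieAlgebra K L] (c : List ℕ) : Prop :=
  IsGreatest {l : List ℕ | ∃ X : L, X ∉ LieModule.lowerCentralSeries K L L 1 ∧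
    HasJordanBlocks (LieAlgebra.ad K L X) l} c

end CharacteristicSequence

/-! ### Lie algebras given by Maurer–Cartan equations -/

/-- Maurer–Cartan equations on `n` forms `α 0, …, α (n - 1)`: the entry `(a, i, j)` of the list
`d k` stands for the term `a • α i ∧ α j` of `dα k`. Only closed forms occur on the
right-hand sides, so that these are the equations of a Lie algebra with central derived algebra. -/
structure MaurerCartan (n : ℕ) where
  d : Fin n → List (ℤ × Fin n × Fin n)
  closed : ∀ k, ∀ t ∈ d k, d t.2.1 = [] ∧ d t.2.2 = []

/-- The underlying space `Kⁿ` of the Lie algebra over `K` with Maurer–Cartan equations `D`; its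
standard basis is dual to the forms `α 0, …, α (n - 1)`. -/
def MCAlg (K : Type*) {n : ℕ} (_D : MaurerCartan n) : Type _ := Fin n → K

namespace MCAlg

variable {K : Type*} [Field K] {n : ℕ} {D : MaurerCartan n}

instance : AddCommGroup (MCAlg K D) := inferInstanceAs (AddCommGroup (Fin n → K))

instance : Module K (MCAlg K D) := inferInstanceAs (Module K (Fin n → K))

/-- The coordinate `α k` of the bracket `[x, y]` is `dα k (x, y)`, where
`(α i ∧ α j) (x, y) = x i * y j - x j * y i`. -/
instance : Bracket (MCAlg K D) (MCAlg K D) where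
  bracket x y := fun k =>
    ((D.d k).map fun t => (t.1 : K) * (x t.2.1 * y t.2.2 - x t.2.2 * y t.2.1)).sum

theorem bracket_apply (x y : MCAlg K D) (k : Fin n) : ⁅x, y⁆ k =
    ((D.d k).map fun t => (t.1 : K) * (x t.2.1 * y t.2.2 - x t.2.2 * y t.2.1)).sum := rfl

theorem add_apply (x y : MCAlg K D) (k : Fin n) : (x + y) k = x k + y k := rfl

theorem smul_apply (a : K) (x : MCAlg K D) (k : Fin n) : (a • x) k = a * x k := rfl

theorem zero_apply (k : Fin n) : (0 : MCAlg K D) k = 0 := rfl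

theorem bracket_apply_of_nil (x y : MCAlg K D) {k : Fin n} (h : D.d k = []) : ⁅x, y⁆ k = 0 := by
  rw [bracket_apply, h]; rfl

theorem bracket_bracket (x y z : MCAlg K D) : ⁅x, ⁅y, z⁆⁆ = 0 := by
  funext k
  rw [bracket_apply, zero_apply]
  apply List.sum_eq_zero
  intro a ha
  obtain ⟨t, ht, rfl⟩ := List.mem_map.1 ha
  obtain ⟨h1, h2⟩ := D.closed k t ht
  rw [bracket_apply_of_nil y z h1, bracket_apply_of_nil y z h2]
  ring

theorem bracket_skew (x y : MCAlg K D) : ⁅x, y⁆ + ⁅y, x⁆ = 0 := by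
  funext k
  rw [add_apply, zero_apply, bracket_apply, bracket_apply, ← List.sum_map_add]
  apply List.sum_eq_zero
  intro a ha
  obtain ⟨t, _, rfl⟩ := List.mem_map.1 ha
  ring

instance : LieRing (MCAlg K D) where
  add_lie x y z := by
    funext k
    rw [add_apply, bracket_apply, bracket_apply, bracket_apply, ← List.sum_map_add]
    refine congrArg List.sum (List.map_congr_left fun t _ => ?_)
    rw [add_apply, add_apply]; ring
  lie_add x y z := by
    funext k
    rw [add_apply, bracket_apply, bracket_apply, bracket_apply, ← List.sum_map_add]
    refine congrArg List.sum (List.map_congr_left fun t _ => ?_)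
    rw [add_apply, add_apply]; ring
  lie_self x := by
    funext k
    rw [bracket_apply, zero_apply]
    apply List.sum_eq_zero
    intro a ha
    obtain ⟨t, _, rfl⟩ := List.mem_map.1 ha
    ring
  leibniz_lie x y z := by
    rw [bracket_bracket, bracket_bracket, add_zero,
      eq_neg_of_add_eq_zero_left (bracket_skew ⁅x, y⁆ z), bracket_bracket, neg_zero]

instance : LieAlgebra K (MCAlg K D) where
  lie_smul a x y := by
    funext k
    rw [smul_apply, bracket_apply, bracket_apply, ← List.sum_map_mul_left]
    refine congrArg List.sum (List.map_congr_left fun t _ => ?_)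
    rw [smul_apply, smul_apply]; ring

end MCAlg

/-! ### The Lie algebras of the classification

The forms are numbered from 0 in the code, so the form `αᵢ` of the comments is number `i - 1`.
All forms whose differential is not mentioned are closed. -/

/-- The abelian Lie algebra `Kᵐ`. -/
def abelian (m : ℕ) : MaurerCartan m := ⟨fun _ => [], by simp⟩

/-- `dα₃ = α₁ ∧ α₂` (the Heisenberg algebra). -/
def n3_1 : MaurerCartan 3 := ⟨![[], [], [(1, 0, 1)]], by decide⟩

/-- `dα₃ = α₁ ∧ α₂`, `dα₅ = α₁ ∧ α₄`. -/
def n5_5 : MaurerCartan 5 := ⟨![[], [], [(1, 0, 1)], [], [(1, 0, 3)]], by decide⟩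

/-- `dα₃ = α₁ ∧ α₂`, `dα₅ = α₁ ∧ α₄ + α₂ ∧ α₆`. -/
def n6_19 : MaurerCartan 6 :=
  ⟨![[], [], [(1, 0, 1)], [], [(1, 0, 3), (1, 1, 5)], []], by decide⟩

/-- `dα₃ = α₁ ∧ α₂`, `dα₅ = α₁ ∧ α₄`, `dα₆ = α₂ ∧ α₄`. -/
def n6_20 : MaurerCartan 6 :=
  ⟨![[], [], [(1, 0, 1)], [], [(1, 0, 3)], [(1, 1, 3)]], by decide⟩

/-- `dα₃ = α₁ ∧ α₂ + α₄ ∧ α₆`, `dα₅ = α₁ ∧ α₄ - α₂ ∧ α₆`. -/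
def n6_20_1 : MaurerCartan 6 :=
  ⟨![[], [], [(1, 0, 1), (1, 3, 5)], [], [(1, 0, 3), (-1, 1, 5)], []], by decide⟩

/-- `dα₃ = α₁ ∧ α₂ + α₄ ∧ α₇`, `dα₅ = α₁ ∧ α₄ + α₆ ∧ α₇`. -/
def n7_124 : MaurerCartan 7 :=
  ⟨![[], [], [(1, 0, 1), (1, 3, 6)], [], [(1, 0, 3), (1, 5, 6)], [], []], by decide⟩

/-- The two Lie algebras over `K` are isomorphic. -/
def Iso (K : Type*) [Field K] (L L' : Type*) [LieRing L] [LieAlgebra K L] [LieRing L']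
    [LieAlgebra K L'] : Prop := Nonempty (L ≃ₗ⁅K⁆ L')

end SymplecticTwoStep

/-! If some `ad U` had rank at least 3, its Jordan sequence would begin with three 2s and exceed the
characteristic sequence. So every `ad U` has rank at most 2, and some `ad X` has independent values
`⁅X, Y⁆`, `⁅X, Z⁆`. The 3×3 minors of `ad (X + t u)` vanish for all `t`; their linear terms in `t`
show that brackets with `ker (ad X)` stay in the range of `ad X`. Hence `⁅X, Y⁆`, `⁅X, Z⁆`, `⁅Y, Z⁆`
span the derived algebra.

If these three are independent, the rank condition forces a splitting of the algebra into a free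
2-step algebra on `X, Y, Z` and a central complement (`iso_n6_20`).

Otherwise the derived algebra is a plane with coordinates `A, B`. Put `α = θ ⁅X, Y⁆` and `β = θ ⁅X,
Z⁆`. Closedness of `θ` reads `dA ∧ α + dB ∧ β = 0`, and an argument in the style of Cartan's lemma
gives `dA = α ∧ μ + β ∧ ν`, `dB = α ∧ ν + β ∧ ρ` (`IsSymplectic.exists_isPencil`). A change of basis
of the plane acts on the symmetric matrix of `μ, ν, ρ` by congruence. If there is no relation
between these forms modulo `α, β`, the algebra is `n7_124`; a single relation is a binary quadratic
form, and its type (square, split, anisotropic) gives `n6_19`, the sum of two copies of `n3_1`, or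
`n6_20_1`. Further relations leave only three closed forms and give `n5_5`
(`IsPencil.classification`).

The nonabelian factors have dimension at most 7 < 2p, so the abelian factor is nonzero and the
algebra decomposes. -/

namespace SymplecticTwoStep

open Module

/-! ### Recognising a product with an abelian algebra from linear forms -/

section IsoCriterion

variable {K : Type*} [Field K] {L : Type*} [LieRing L] [LieAlgebra K L]

theorem abelian_bracket {m : ℕ} (x y : MCAlg K (abelian m)) : ⁅x, y⁆ = 0 := by
  funext k
  exact MCAlg.bracket_apply_of_nil x y rfl

/-- The underlying space of `MCAlg K D` is `Kⁿ`. -/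
def MCAlg.equivFun {n : ℕ} (D : MaurerCartan n) : MCAlg K D ≃ₗ[K] (Fin n → K) :=
  LinearEquiv.refl K (Fin n → K)

theorem MCAlg.finrank_eq {n : ℕ} (D : MaurerCartan n) : finrank K (MCAlg K D) = n := by
  rw [(MCAlg.equivFun D).finrank_eq, finrank_fin_fun]

instance {n : ℕ} (D : MaurerCartan n) : FiniteDimensional K (MCAlg K D) :=
  inferInstanceAs (FiniteDimensional K (Fin n → K))

instance {n : ℕ} [NeZero n] (D : MaurerCartan n) : Nontrivial (MCAlg K D) :=
  inferInstanceAs (Nontrivial (Fin n → K))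

/-- A surjective homomorphism onto `M` that is injective on the derived algebra identifies `L`
with the product of `M` and an abelian algebra. -/
theorem iso_prod_abelian {M : Type*} [LieRing M] [LieAlgebra K M] [FiniteDimensional K L]
    [FiniteDimensional K M]
    (φ : L →ₗ⁅K⁆ M) (hφ : Function.Surjective φ) (D : Submodule K L)
    (hD : ∀ x y : L, ⁅x, y⁆ ∈ D) (hinj : ∀ z ∈ D, φ z = 0 → z = 0) {m : ℕ}
    (hm : finrank K L = finrank K M + m) : Iso K L (M × MCAlg K (abelian m)) := by
  set N : Submodule K L := LinearMap.ker (φ : L →ₗ[K] M) with hN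
  have hdisj : Disjoint D N := by
    rw [Submodule.disjoint_def]
    exact fun z hz hz' => hinj z hz hz'
  -- The complement of the kernel is chosen to contain all brackets, so that projection onto the
  -- kernel along it kills brackets and is a homomorphism to an abelian algebra.
  obtain ⟨C, hDC, hC⟩ := hdisj.exists_isCompl
  have hrank : finrank K N = m := by
    have h1 := LinearMap.finrank_range_add_finrank_ker (φ : L →ₗ[K] M)
    rw [LinearMap.range_eq_top.2 hφ, finrank_top] at h1
    change _ + finrank K N = _ at h1
    omega
  let e : N ≃ₗ[K] MCAlg K (abelian m) :=
    LinearEquiv.ofFinrankEq _ _ (by rw [hrank, MCAlg.finrank_eq])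
  let ψ : L →ₗ[K] MCAlg K (abelian m) := e.toLinearMap ∘ₗ N.projectionOnto C hC.symm
  let Φ : L →ₗ[K] M × MCAlg K (abelian m) := (φ : L →ₗ[K] M).prod ψ
  have hΦ : Function.Injective Φ := by
    rw [injective_iff_map_eq_zero]
    intro x hx
    have h1 : φ x = 0 := congrArg Prod.fst hx
    have h2 : ψ x = 0 := congrArg Prod.snd hx
    have h3 : N.projectionOnto C hC.symm x = 0 := e.map_eq_zero_iff.1 h2
    rw [Submodule.projectionOnto_apply_of_mem_left hC.symm (show x ∈ N from h1)] at h3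
    exact congrArg Subtype.val h3
  have hΦ' : Function.Surjective Φ := by
    refine (LinearMap.injective_iff_surjective_of_finrank_eq_finrank ?_).1 hΦ
    rw [finrank_prod, MCAlg.finrank_eq, hm]
  have hψ : ∀ x y : L, ψ ⁅x, y⁆ = 0 := by
    intro x y
    have : N.projectionOnto C hC.symm ⁅x, y⁆ = 0 :=
      (Submodule.projectionOnto_apply_eq_zero_iff hC.symm).2 (hDC (hD x y))
    change e _ = 0
    rw [this, map_zero]
  exact ⟨{ LinearEquiv.ofBijective Φ ⟨hΦ, hΦ'⟩ with
    map_lie' := by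
      intro x y
      change (φ ⁅x, y⁆, ψ ⁅x, y⁆) = (⁅φ x, φ y⁆, ⁅ψ x, ψ y⁆)
      rw [LieHom.map_lie, hψ, abelian_bracket] }⟩

theorem isDecomposable_of_iso {M : Type*} [LieRing M] [LieAlgebra K M] {m : ℕ} (hm : 0 < m)
    [Nontrivial M] (h : Iso K L (M × MCAlg K (abelian m))) : IsDecomposable K L := by
  obtain ⟨e⟩ := h
  let f : L →ₗ⁅K⁆ M := (LieHom.fst K M (MCAlg K (abelian m))).comp (e : L →ₗ⁅K⁆ _)
  let g : L →ₗ⁅K⁆ MCAlg K (abelian m) :=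
    (LieHom.snd K M (MCAlg K (abelian m))).comp (e : L →ₗ⁅K⁆ _)
  have e0 : e 0 = 0 := e.toLinearEquiv.map_zero
  have e0' : e.symm 0 = 0 := e.symm.toLinearEquiv.map_zero
  have hf : ∀ x, f x = (e x).1 := fun x => rfl
  have hg : ∀ x, g x = (e x).2 := fun x => rfl
  refine ⟨f.ker, g.ker, ?_, ?_, ?_⟩
  · rw [Ne, LieSubmodule.eq_bot_iff]
    intro h
    have h1 := h (e.symm (0, fun _ => 1)) (by rw [LieHom.mem_ker, hf, e.apply_symm_apply])
    have h2 := congrArg (fun x => (e x).2) h1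
    simp only [LieEquiv.apply_symm_apply, e0] at h2
    exact one_ne_zero (congrFun h2 ⟨0, hm⟩ : (1 : K) = 0)
  · rw [Ne, LieSubmodule.eq_bot_iff]
    intro h
    obtain ⟨a, ha⟩ := exists_ne (0 : M)
    have h1 := h (e.symm (a, 0)) (by rw [LieHom.mem_ker, hg, e.apply_symm_apply])
    have h2 := congrArg (fun x => (e x).1) h1
    simp only [LieEquiv.apply_symm_apply, e0] at h2
    exact ha h2
  · constructor
    · rw [disjoint_iff, LieSubmodule.eq_bot_iff]
      intro x hx
      obtain ⟨h1, h2⟩ := (LieSubmodule.mem_inf _ _ _).1 hx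
      rw [LieHom.mem_ker, hf] at h1
      rw [LieHom.mem_ker, hg] at h2
      have : e x = 0 := Prod.ext h1 h2
      rw [← e.symm_apply_apply x, this, e0']
    · rw [codisjoint_iff, eq_top_iff]
      intro x _
      rw [LieSubmodule.mem_sup]
      refine ⟨e.symm (0, (e x).2), ?_, e.symm ((e x).1, 0), ?_, ?_⟩
      · rw [LieHom.mem_ker, hf, e.apply_symm_apply]
      · rw [LieHom.mem_ker, hg, e.apply_symm_apply]
      · apply e.injective
        change e.toLinearEquiv (_ + _) = _
        rw [map_add]
        change e _ + e _ = e x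
        rw [e.apply_symm_apply, e.apply_symm_apply]
        simp

/-- Independence of the forms is injectivity of the dual of the joint evaluation map, which is
equivalent to surjectivity of that map. -/
theorem exists_apply_eq_of_linearIndependent {V ι : Type*} [AddCommGroup V] [Module K V]
    [Fintype ι] {φ : ι → Dual K V} (h : LinearIndependent K φ) (c : ι → K) :
    ∃ x, ∀ i, φ i x = c i := by
  classical
  have hs : Function.Surjective (LinearMap.pi φ) := by
    rw [← LinearMap.dualMap_injective_iff, injective_iff_map_eq_zero]
    intro F hF
    have h0 : ∀ i, F (Pi.single i 1) = 0 := by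
      refine Fintype.linearIndependent_iff.1 h _ ?_
      ext x
      have h1 : F (LinearMap.pi φ x) = 0 := LinearMap.congr_fun hF x
      rw [LinearMap.pi_apply_eq_sum_univ] at h1
      rw [LinearMap.sum_apply, LinearMap.zero_apply, ← h1]
      refine Finset.sum_congr rfl fun i _ => ?_
      rw [LinearMap.smul_apply, smul_eq_mul, smul_eq_mul, LinearMap.pi_apply, mul_comm]
      congr 2
      funext j
      simp [Pi.single_apply, eq_comm]
    ext i
    simpa using h0 i
  obtain ⟨x, hx⟩ := hs c
  exact ⟨x, fun i => congrFun hx i⟩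

/-- The homomorphism to the algebra with Maurer–Cartan equations `D` given by linear forms that
satisfy these equations. -/
def MCAlg.lift {n : ℕ} (D : MaurerCartan n) (φ : Fin n → Dual K L)
    (h : ∀ k x y, φ k ⁅x, y⁆ = ((D.d k).map fun t =>
      (t.1 : K) * (φ t.2.1 x * φ t.2.2 y - φ t.2.2 x * φ t.2.1 y)).sum) : L →ₗ⁅K⁆ MCAlg K D where
  toFun x := fun k => φ k x
  map_add' x y := by funext k; exact map_add (φ k) x y
  map_smul' a x := by funext k; exact map_smul (φ k) a x
  map_lie' := by
    intro x y
    funext k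
    exact h k x y

/-- Independence makes the lifted homomorphism surjective. This reduces an isomorphism to exhibiting
forms that satisfy the Maurer–Cartan equations and separate the derived algebra. -/
theorem iso_of_forms [FiniteDimensional K L] {n : ℕ} (D : MaurerCartan n) (φ : Fin n → Dual K L)
    (h : ∀ k x y, φ k ⁅x, y⁆ = ((D.d k).map fun t =>
      (t.1 : K) * (φ t.2.1 x * φ t.2.2 y - φ t.2.2 x * φ t.2.1 y)).sum)
    (hli : LinearIndependent K φ) (E : Submodule K L)
    (hE : ∀ x y : L, ⁅x, y⁆ ∈ E) (hinj : ∀ z ∈ E, (∀ k, φ k z = 0) → z = 0) {m : ℕ}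
    (hm : finrank K L = n + m) : Iso K L (MCAlg K D × MCAlg K (abelian m)) := by
  refine iso_prod_abelian (MCAlg.lift D φ h) ?_ E hE ?_ (by rw [MCAlg.finrank_eq, hm])
  · intro c
    obtain ⟨x, hx⟩ := exists_apply_eq_of_linearIndependent hli c
    exact ⟨x, funext hx⟩
  · exact fun z hz h0 => hinj z hz fun k => congrFun h0 k

end IsoCriterion

/-! ### Normal forms when the derived algebra is a plane -/

section Forms

variable {K : Type*} [Field K] {L : Type*} [LieRing L] [LieAlgebra K L]

/-- The exterior product of two linear forms, evaluated at a pair of vectors. -/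
def wedge (f g : Dual K L) (x y : L) : K := f x * g y - g x * f y

/-- `D` contains all brackets, and the linear forms `A`, `B` are coordinates on the span of the
brackets. -/
structure IsFramed (D : Submodule K L) (A B : Dual K L) : Prop where
  lie_mem : ∀ x y : L, ⁅x, y⁆ ∈ D
  eq_zero : ∀ z ∈ D, A z = 0 → B z = 0 → z = 0
  indep : ∀ s t : K, (∀ x y : L, s * A ⁅x, y⁆ + t * B ⁅x, y⁆ = 0) → s = 0 ∧ t = 0

theorem IsFramed.transform {D : Submodule K L} {A B : Dual K L} (h : IsFramed D A B)
    {v₁ v₂ w₁ w₂ : K} (hδ : v₁ * w₂ - v₂ * w₁ ≠ 0) :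
    IsFramed D (v₁ • A + v₂ • B) (w₁ • A + w₂ • B) where
  lie_mem := h.lie_mem
  eq_zero z hz h1 h2 := by
    simp only [LinearMap.add_apply, LinearMap.smul_apply, smul_eq_mul] at h1 h2
    refine h.eq_zero z hz (mul_left_cancel₀ hδ ?_) (mul_left_cancel₀ hδ ?_)
    · linear_combination w₂ * h1 - v₂ * h2
    · linear_combination v₁ * h2 - w₁ * h1
  indep s t hst := by
    obtain ⟨h1, h2⟩ := h.indep (s * v₁ + t * w₁) (s * v₂ + t * w₂) fun x y => by
      have := hst x y
      simp only [LinearMap.add_apply, LinearMap.smul_apply, smul_eq_mul] at this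
      linear_combination this
    refine ⟨mul_left_cancel₀ hδ ?_, mul_left_cancel₀ hδ ?_⟩
    · linear_combination w₂ * h1 - w₁ * h2
    · linear_combination v₁ * h2 - v₂ * h1

variable [FiniteDimensional K L] {D : Submodule K L} {A B : Dual K L} {m : ℕ}

theorem IsFramed.iso_n5_5 (hF : IsFramed D A B) {f g h : Dual K L}
    (hA : ∀ x y, A ⁅x, y⁆ = wedge f g x y) (hB : ∀ x y, B ⁅x, y⁆ = wedge f h x y)
    (hf : ∀ x y : L, f ⁅x, y⁆ = 0) (hg : ∀ x y : L, g ⁅x, y⁆ = 0) (hh : ∀ x y : L, h ⁅x, y⁆ = 0)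
    (hli : ∀ a b c : K, a • f + b • g + c • h = 0 → a = 0 ∧ b = 0 ∧ c = 0)
    (hm : finrank K L = 5 + m) : Iso K L (MCAlg K n5_5 × MCAlg K (abelian m)) := by
  refine iso_of_forms n5_5 ![f, g, A, h, B] ?_ ?_ D hF.lie_mem ?_ hm
  · intro k x y
    fin_cases k <;> simp [n5_5, hf, hg, hh, hA, hB, wedge]
  · rw [Fintype.linearIndependent_iff]
    intro c hc
    simp only [Fin.sum_univ_five, Matrix.cons_val] at hc
    -- Closed forms vanish on brackets, so evaluation there isolates the coefficients of `A` and
    -- `B`.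
    obtain ⟨h2, h4⟩ := hF.indep (c 2) (c 4) fun x y => by
      simpa [hf, hg, hh] using LinearMap.congr_fun hc ⁅x, y⁆
    obtain ⟨h0, h1, h3⟩ := hli (c 0) (c 1) (c 3) (by simpa [h2, h4] using hc)
    intro i
    fin_cases i <;> assumption
  · exact fun z hz h0 => hF.eq_zero z hz (h0 2) (h0 4)

/-- Two 2-forms in three variables share a linear factor: its coefficients are the cross product of
the coefficient vectors `p` and `q`, here `(-r, -s, δ)`. The new coordinates on the derived algebra
eliminate `γ ∧ α` from one differential and `β ∧ γ` from the other. -/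
theorem IsFramed.iso_n5_5_of_ne_zero (hF : IsFramed D A B) {α β γ : Dual K L}
    {p₁ p₂ p₃ q₁ q₂ q₃ : K}
    (hA : ∀ x y, A ⁅x, y⁆ = p₁ * wedge β γ x y + p₂ * wedge γ α x y + p₃ * wedge α β x y)
    (hB : ∀ x y, B ⁅x, y⁆ = q₁ * wedge β γ x y + q₂ * wedge γ α x y + q₃ * wedge α β x y)
    (hα : ∀ x y : L, α ⁅x, y⁆ = 0) (hβ : ∀ x y : L, β ⁅x, y⁆ = 0) (hγ : ∀ x y : L, γ ⁅x, y⁆ = 0)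
    (hli : ∀ a b c : K, a • α + b • β + c • γ = 0 → a = 0 ∧ b = 0 ∧ c = 0)
    (hδ : p₁ * q₂ - p₂ * q₁ ≠ 0)
    (hm : finrank K L = 5 + m) : Iso K L (MCAlg K n5_5 × MCAlg K (abelian m)) := by
  have hF' := hF.transform (v₁ := q₂) (v₂ := -p₂) (w₁ := -q₁) (w₂ := p₁)
    (by convert hδ using 1; ring)
  set δ := p₁ * q₂ - p₂ * q₁ with hδ'
  set r := q₂ * p₃ - p₂ * q₃ with hr
  set s := p₁ * q₃ - q₁ * p₃ with hs
  refine hF'.iso_n5_5 (f := δ • γ - r • α - s • β) (g := -β) (h := α) ?_ ?_ ?_ ?_ ?_ ?_ hm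
  · intro x y
    simp only [LinearMap.add_apply, LinearMap.smul_apply, LinearMap.sub_apply, LinearMap.neg_apply,
      smul_eq_mul, hA, hB, wedge, hδ', hr, hs]
    ring
  · intro x y
    simp only [LinearMap.add_apply, LinearMap.smul_apply, LinearMap.sub_apply, smul_eq_mul, hA, hB,
      wedge, hδ', hr, hs]
    ring
  · intro x y
    simp [hα, hβ, hγ]
  · intro x y
    simp [hβ]
  · exact hα
  · intro a b c h
    obtain ⟨h1, h2, h3⟩ := hli (c - a * r) (-b - a * s) (a * δ) (by rw [← h]; module)
    have ha : a = 0 := (mul_eq_zero.1 h3).resolve_right hδ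
    subst ha
    refine ⟨rfl, ?_, ?_⟩
    · linear_combination -h2
    · linear_combination h1

theorem IsFramed.iso_n5_5_of_three_forms (hF : IsFramed D A B) {α β γ : Dual K L}
    {p₁ p₂ p₃ q₁ q₂ q₃ : K}
    (hA : ∀ x y, A ⁅x, y⁆ = p₁ * wedge β γ x y + p₂ * wedge γ α x y + p₃ * wedge α β x y)
    (hB : ∀ x y, B ⁅x, y⁆ = q₁ * wedge β γ x y + q₂ * wedge γ α x y + q₃ * wedge α β x y)
    (hα : ∀ x y : L, α ⁅x, y⁆ = 0) (hβ : ∀ x y : L, β ⁅x, y⁆ = 0) (hγ : ∀ x y : L, γ ⁅x, y⁆ = 0)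
    (hli : ∀ a b c : K, a • α + b • β + c • γ = 0 → a = 0 ∧ b = 0 ∧ c = 0)
    (hm : finrank K L = 5 + m) : Iso K L (MCAlg K n5_5 × MCAlg K (abelian m)) := by
  by_cases h3 : p₁ * q₂ - p₂ * q₁ = 0
  swap
  · exact hF.iso_n5_5_of_ne_zero hA hB hα hβ hγ hli h3 hm
  by_cases h1 : p₂ * q₃ - p₃ * q₂ = 0
  swap
  · refine hF.iso_n5_5_of_ne_zero (α := β) (β := γ) (γ := α) (p₃ := p₁) (q₃ := q₁)
      (fun x y => ?_) (fun x y => ?_) hβ hγ hα (fun a b c h => ?_) h1 hm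
    · rw [hA]; ring
    · rw [hB]; ring
    · obtain ⟨h1, h2, h3⟩ := hli c a b (by rw [← h]; module)
      exact ⟨h2, h3, h1⟩
  by_cases h2 : p₃ * q₁ - p₁ * q₃ = 0
  swap
  · refine hF.iso_n5_5_of_ne_zero (α := γ) (β := α) (γ := β) (p₃ := p₂) (q₃ := q₂)
      (fun x y => ?_) (fun x y => ?_) hγ hα hβ (fun a b c h => ?_) h2 hm
    · rw [hA]; ring
    · rw [hB]; ring
    · obtain ⟨h1, h2, h3⟩ := hli b c a (by rw [← h]; module)
      exact ⟨h3, h1, h2⟩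
  -- With all 2×2 minors zero, `p` and `q` are proportional, against the independence of `dA` and
  -- `dB`.
  exfalso
  have e1 := (hF.indep q₁ (-p₁) fun x y => by
    rw [hA, hB]; linear_combination wedge α β x y * h2 - wedge γ α x y * h3).2
  have e2 := (hF.indep q₂ (-p₂) fun x y => by
    rw [hA, hB]; linear_combination wedge β γ x y * h3 - wedge α β x y * h1).2
  have e3 := (hF.indep q₃ (-p₃) fun x y => by
    rw [hA, hB]; linear_combination wedge γ α x y * h1 - wedge β γ x y * h2).2
  rw [neg_eq_zero] at e1 e2 e3
  exact one_ne_zero (hF.indep 1 0 fun x y => by rw [hA, e1, e2, e3]; ring).1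

/-- The normal form of a framed algebra with a symplectic form: the differentials of `A` and `B`
are the entries of the product of a symmetric matrix of linear forms with `(α, β)`. -/
structure IsPencil (D : Submodule K L) (A B α β μ ν ρ : Dual K L) : Prop
    extends IsFramed D A B where
  lie_left : ∀ x y : L, A ⁅x, y⁆ = wedge α μ x y + wedge β ν x y
  lie_right : ∀ x y : L, B ⁅x, y⁆ = wedge α ν x y + wedge β ρ x y
  α_lie : ∀ x y : L, α ⁅x, y⁆ = 0
  β_lie : ∀ x y : L, β ⁅x, y⁆ = 0
  μ_lie : ∀ x y : L, μ ⁅x, y⁆ = 0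
  ν_lie : ∀ x y : L, ν ⁅x, y⁆ = 0
  ρ_lie : ∀ x y : L, ρ ⁅x, y⁆ = 0
  forms : ∀ s t : K, s • α + t • β = 0 → s = 0 ∧ t = 0

variable {α β μ ν ρ : Dual K L}

omit [FiniteDimensional K L] in
-- With `P` the matrix of rows `v, w` and `M` the symmetric matrix of `μ, ν, ρ`: `(A, B)` transforms
-- by `P`, `(α, β)` by the inverse transpose of `P`, and `M` becomes `P M Pᵀ`, which is again
-- symmetric.
theorem IsPencil.transform (h : IsPencil D A B α β μ ν ρ)
    {v₁ v₂ w₁ w₂ : K} (hδ : v₁ * w₂ - v₂ * w₁ ≠ 0) :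
    IsPencil D (v₁ • A + v₂ • B) (w₁ • A + w₂ • B)
      ((v₁ * w₂ - v₂ * w₁)⁻¹ • (w₂ • α - w₁ • β)) ((v₁ * w₂ - v₂ * w₁)⁻¹ • (v₁ • β - v₂ • α))
      ((v₁ * v₁) • μ + (2 * v₁ * v₂) • ν + (v₂ * v₂) • ρ)
      ((v₁ * w₁) • μ + (v₁ * w₂ + v₂ * w₁) • ν + (v₂ * w₂) • ρ)
      ((w₁ * w₁) • μ + (2 * w₁ * w₂) • ν + (w₂ * w₂) • ρ) where
  toIsFramed := h.toIsFramed.transform hδ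
  lie_left x y := by
    simp only [LinearMap.add_apply, LinearMap.smul_apply, LinearMap.sub_apply, smul_eq_mul,
      h.lie_left, h.lie_right, wedge]
    linear_combination -(v₁ * (α x * μ y - μ x * α y + (β x * ν y - ν x * β y)) +
      v₂ * (α x * ν y - ν x * α y + (β x * ρ y - ρ x * β y))) * inv_mul_cancel₀ hδ
  lie_right x y := by
    simp only [LinearMap.add_apply, LinearMap.smul_apply, LinearMap.sub_apply, smul_eq_mul,
      h.lie_left, h.lie_right, wedge]
    linear_combination -(w₁ * (α x * μ y - μ x * α y + (β x * ν y - ν x * β y)) +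
      w₂ * (α x * ν y - ν x * α y + (β x * ρ y - ρ x * β y))) * inv_mul_cancel₀ hδ
  α_lie x y := by simp [h.α_lie, h.β_lie]
  β_lie x y := by simp [h.α_lie, h.β_lie]
  μ_lie x y := by simp [h.μ_lie, h.ν_lie, h.ρ_lie]
  ν_lie x y := by simp [h.μ_lie, h.ν_lie, h.ρ_lie]
  ρ_lie x y := by simp [h.μ_lie, h.ν_lie, h.ρ_lie]
  forms s t hst := by
    set d := v₁ * w₂ - v₂ * w₁ with hd
    obtain ⟨h1, h2⟩ := h.forms (d⁻¹ * (s * w₂ - t * v₂)) (d⁻¹ * (t * v₁ - s * w₁))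
      (by rw [← hst]; module)
    have h1' := (mul_eq_zero.1 h1).resolve_left (inv_ne_zero hδ)
    have h2' := (mul_eq_zero.1 h2).resolve_left (inv_ne_zero hδ)
    refine ⟨mul_left_cancel₀ hδ ?_, mul_left_cancel₀ hδ ?_⟩
    · linear_combination v₁ * h1' + v₂ * h2' + s * hd
    · linear_combination w₁ * h1' + w₂ * h2' + t * hd

/-- The span of `α`, `β`, `γ` contains `μ`, `ν`, `ρ`. -/
theorem IsPencil.iso_n5_5 (h : IsPencil D A B α β μ ν ρ) {γ : Dual K L}
    (hγ : ∀ x y : L, γ ⁅x, y⁆ = 0) {m₁ m₂ m₃ n₁ n₂ n₃ r₁ r₂ r₃ : K}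
    (hμ : μ = m₁ • α + m₂ • β + m₃ • γ) (hν : ν = n₁ • α + n₂ • β + n₃ • γ)
    (hρ : ρ = r₁ • α + r₂ • β + r₃ • γ)
    (hm : finrank K L = 5 + m) : Iso K L (MCAlg K n5_5 × MCAlg K (abelian m)) := by
  by_cases hli : ∀ a b c : K, a • α + b • β + c • γ = 0 → a = 0 ∧ b = 0 ∧ c = 0
  · refine h.toIsFramed.iso_n5_5_of_three_forms (p₁ := n₃) (p₂ := -m₃) (p₃ := m₂ - n₁)
      (q₁ := r₃) (q₂ := -n₃) (q₃ := n₂ - r₁) ?_ ?_ h.α_lie h.β_lie hγ hli hm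
    · intro x y
      rw [h.lie_left, hμ, hν]
      simp only [LinearMap.add_apply, LinearMap.smul_apply, smul_eq_mul, wedge]
      ring
    · intro x y
      rw [h.lie_right, hρ, hν]
      simp only [LinearMap.add_apply, LinearMap.smul_apply, smul_eq_mul, wedge]
      ring
  -- If `γ` depends on `α, β`, both differentials are multiples of `α ∧ β`, hence dependent.
  · exfalso
    push Not at hli
    obtain ⟨a, b, c, habc, hne⟩ := hli
    have hc : c ≠ 0 := by
      rintro rfl
      obtain ⟨h1, h2⟩ := h.forms a b (by rw [← habc]; module)
      exact hne h1 h2 rfl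
    have hγ' : γ = (-(a / c)) • α + (-(b / c)) • β := by
      have : c • (γ - ((-(a / c)) • α + (-(b / c)) • β)) = 0 := by
        rw [← habc]
        match_scalars <;> field_simp
      exact sub_eq_zero.1 ((smul_eq_zero.1 this).resolve_left hc)
    set k := -(a / c)
    set l := -(b / c)
    have hA : ∀ x y : L, A ⁅x, y⁆ = (m₂ + m₃ * l - n₁ - n₃ * k) * wedge α β x y := by
      intro x y
      rw [h.lie_left, hμ, hν, hγ']
      simp only [LinearMap.add_apply, LinearMap.smul_apply, smul_eq_mul, wedge]
      ring
    have hB : ∀ x y : L, B ⁅x, y⁆ = (n₂ + n₃ * l - r₁ - r₃ * k) * wedge α β x y := by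
      intro x y
      rw [h.lie_right, hρ, hν, hγ']
      simp only [LinearMap.add_apply, LinearMap.smul_apply, smul_eq_mul, wedge]
      ring
    have h1 := (h.indep (n₂ + n₃ * l - r₁ - r₃ * k) (-(m₂ + m₃ * l - n₁ - n₃ * k)) fun x y => by
      rw [hA, hB]; ring).2
    rw [neg_eq_zero] at h1
    exact one_ne_zero (h.indep 1 0 fun x y => by rw [hA, h1]; ring).1

omit [FiniteDimensional K L] in
-- Since `α, β` are independent, the relation involves `x` or `y`; solving for that one leaves the
-- other as `γ`. This feeds the degenerate cases into `IsPencil.iso_n5_5`.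
theorem exists_span_of_dependent {x y : Dual K L}
    (hαβ : ∀ s t : K, s • α + t • β = 0 → s = 0 ∧ t = 0)
    (hdep : ¬ ∀ a b c d : K, a • α + b • β + c • x + d • y = 0 → a = 0 ∧ b = 0 ∧ c = 0 ∧ d = 0) :
    ∃ γ, (γ = x ∨ γ = y) ∧ (∃ k l n : K, x = k • α + l • β + n • γ) ∧
      ∃ k l n : K, y = k • α + l • β + n • γ := by
  push Not at hdep
  obtain ⟨a, b, c, d, h0, hne⟩ := hdep
  by_cases hc : c = 0
  · subst hc
    have hd : d ≠ 0 := by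
      rintro rfl
      obtain ⟨h1, h2⟩ := hαβ a b (by rw [← h0]; module)
      exact hne h1 h2 rfl rfl
    refine ⟨x, Or.inl rfl, ⟨0, 0, 1, by module⟩, -(a / d), -(b / d), 0, ?_⟩
    have : d • (y - (-(a / d) • α + -(b / d) • β + (0 : K) • x)) = 0 := by
      rw [← h0]
      match_scalars <;> (field_simp; try simp)
    exact sub_eq_zero.1 ((smul_eq_zero.1 this).resolve_left hd)
  · refine ⟨y, Or.inr rfl, ⟨-(a / c), -(b / c), -(d / c), ?_⟩, 0, 0, 1, by module⟩
    have : c • (x - (-(a / c) • α + -(b / c) • β + -(d / c) • y)) = 0 := by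
      rw [← h0]
      match_scalars <;> field_simp
    exact sub_eq_zero.1 ((smul_eq_zero.1 this).resolve_left hc)

theorem IsPencil.iso_n7_124 (h : IsPencil D A B α β μ ν ρ)
    (hli : ∀ a b c d e : K, a • α + b • β + c • μ + d • ν + e • ρ = 0 →
      a = 0 ∧ b = 0 ∧ c = 0 ∧ d = 0 ∧ e = 0)
    (hm : finrank K L = 7 + m) : Iso K L (MCAlg K n7_124 × MCAlg K (abelian m)) := by
  refine iso_of_forms n7_124 ![α, μ, A, ν, B, ρ, -β] ?_ ?_ D h.lie_mem ?_ hm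
  · intro k x y
    fin_cases k <;>
      simp [n7_124, h.α_lie, h.β_lie, h.μ_lie, h.ν_lie, h.ρ_lie, h.lie_left, h.lie_right, wedge] <;>
      ring
  · rw [Fintype.linearIndependent_iff]
    intro c hc
    simp only [Fin.sum_univ_seven, Matrix.cons_val] at hc
    obtain ⟨h2, h4⟩ := h.indep (c 2) (c 4) fun x y => by
      simpa [h.α_lie, h.β_lie, h.μ_lie, h.ν_lie, h.ρ_lie] using LinearMap.congr_fun hc ⁅x, y⁆
    obtain ⟨h0, h6, h1, h3, h5⟩ := hli (c 0) (-c 6) (c 1) (c 3) (c 5) (by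
      rw [← hc, h2, h4]; module)
    rw [neg_eq_zero] at h6
    intro i
    fin_cases i <;> assumption
  · exact fun z hz h0 => h.eq_zero z hz (h0 2) (h0 4)

theorem IsPencil.iso_n6_19_or_n5_5 (h : IsPencil D A B α β μ ν ρ) {k l : K}
    (hμ : μ = k • α + l • β) {m' : ℕ} (hm : finrank K L = 6 + m) (hm' : finrank K L = 5 + m') :
    Iso K L (MCAlg K n6_19 × MCAlg K (abelian m)) ∨
      Iso K L (MCAlg K n5_5 × MCAlg K (abelian m')) := by
  by_cases hli : ∀ a b c d : K, a • α + b • β + c • ν + d • ρ = 0 →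
      a = 0 ∧ b = 0 ∧ c = 0 ∧ d = 0
  · left
    -- With `μ` substituted, `dA = β ∧ (ν - lα)`, and the multiple of `α` does not affect `α ∧ ν` in
    -- `dB`.
    refine iso_of_forms n6_19 ![β, ν - l • α, A, ρ, B, -α] ?_ ?_ D h.lie_mem ?_ hm
    · intro k x y
      fin_cases k <;>
        simp [n6_19, h.α_lie, h.β_lie, h.ν_lie, h.ρ_lie, h.lie_left, h.lie_right, wedge,
          hμ] <;>
        ring
    · rw [Fintype.linearIndependent_iff]
      intro c hc
      simp only [Fin.sum_univ_six, Matrix.cons_val] at hc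
      obtain ⟨h2, h4⟩ := h.indep (c 2) (c 4) fun x y => by
        simpa [h.α_lie, h.β_lie, h.ν_lie, h.ρ_lie] using LinearMap.congr_fun hc ⁅x, y⁆
      obtain ⟨h5, h0, h1, h3⟩ := hli (-c 5 - c 1 * l) (c 0) (c 1) (c 3) (by
        rw [← hc, h2, h4]; module)
      rw [h1, zero_mul, sub_zero, neg_eq_zero] at h5
      intro i
      fin_cases i <;> assumption
    · exact fun z hz h0 => h.eq_zero z hz (h0 2) (h0 4)
  · right
    obtain ⟨γ, hγ, ⟨n₁, n₂, n₃, hν⟩, r₁, r₂, r₃, hρ⟩ := exists_span_of_dependent h.forms hli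
    refine h.iso_n5_5 (γ := γ) ?_ (m₁ := k) (m₂ := l) (m₃ := 0) (by rw [hμ]; module) hν hρ hm'
    rcases hγ with rfl | rfl
    exacts [h.ν_lie, h.ρ_lie]

theorem IsPencil.iso_n3_1_prod_or_n5_5 (h : IsPencil D A B α β μ ν ρ) {k l : K}
    (hν : ν = k • α + l • β) {m' : ℕ} (hm : finrank K L = 6 + m) (hm' : finrank K L = 5 + m') :
    Iso K L ((MCAlg K n3_1 × MCAlg K n3_1) × MCAlg K (abelian m)) ∨
      Iso K L (MCAlg K n5_5 × MCAlg K (abelian m')) := by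
  by_cases hli : ∀ a b c d : K, a • α + b • β + c • μ + d • ρ = 0 →
      a = 0 ∧ b = 0 ∧ c = 0 ∧ d = 0
  · left
    -- The differentials separate: `dA = α ∧ (μ - kβ)` and `dB = β ∧ (ρ - lα)`.
    let φ₁ : L →ₗ⁅K⁆ MCAlg K n3_1 := MCAlg.lift n3_1 ![α, μ - k • β, A] fun i x y => by
      fin_cases i <;> simp [n3_1, h.α_lie, h.β_lie, h.μ_lie, h.lie_left, wedge, hν]
      ring
    let φ₂ : L →ₗ⁅K⁆ MCAlg K n3_1 := MCAlg.lift n3_1 ![β, ρ - l • α, B] fun i x y => by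
      fin_cases i <;> simp [n3_1, h.α_lie, h.β_lie, h.ρ_lie, h.lie_right, wedge, hν]
      ring
    have hind : LinearIndependent K ![α, μ - k • β, A, β, ρ - l • α, B] := by
      rw [Fintype.linearIndependent_iff]
      intro c hc
      simp only [Fin.sum_univ_six, Matrix.cons_val] at hc
      obtain ⟨h2, h5⟩ := h.indep (c 2) (c 5) fun x y => by
        simpa [h.α_lie, h.β_lie, h.μ_lie, h.ρ_lie] using LinearMap.congr_fun hc ⁅x, y⁆
      obtain ⟨h0, h3, h1, h4⟩ := hli (c 0 - c 4 * l) (c 3 - c 1 * k) (c 1) (c 4) (by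
        rw [← hc, h2, h5]; module)
      rw [h4, zero_mul, sub_zero] at h0
      rw [h1, zero_mul, sub_zero] at h3
      intro i
      fin_cases i <;> assumption
    refine iso_prod_abelian (M := MCAlg K n3_1 × MCAlg K n3_1)
      { (φ₁ : L →ₗ[K] MCAlg K n3_1).prod (φ₂ : L →ₗ[K] MCAlg K n3_1) with
        map_lie' := fun {x y} => Prod.ext (LieHom.map_lie φ₁ x y) (LieHom.map_lie φ₂ x y) }
      ?_ D h.lie_mem ?_ ?_
    · rintro ⟨c, d⟩
      obtain ⟨x, hx⟩ := exists_apply_eq_of_linearIndependent hind ![c 0, c 1, c 2, d 0, d 1, d 2]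
      refine ⟨x, Prod.ext (funext fun i => ?_) (funext fun i => ?_)⟩
      · fin_cases i
        exacts [hx 0, hx 1, hx 2]
      · fin_cases i
        exacts [hx 3, hx 4, hx 5]
    · intro z hz h0
      exact h.eq_zero z hz (congrFun (congrArg Prod.fst h0) 2) (congrFun (congrArg Prod.snd h0) 2)
    · rw [finrank_prod, MCAlg.finrank_eq, hm]
  · right
    obtain ⟨γ, hγ, ⟨m₁, m₂, m₃, hμ⟩, r₁, r₂, r₃, hρ⟩ := exists_span_of_dependent h.forms hli
    refine h.iso_n5_5 (γ := γ) ?_ hμ (n₁ := k) (n₂ := l) (n₃ := 0) (by rw [hν]; module) hρ hm'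
    rcases hγ with rfl | rfl
    exacts [h.μ_lie, h.ρ_lie]

theorem IsPencil.iso_n6_20_1_or_n5_5 (h : IsPencil D A B α β μ ν ρ) {k l : K}
    (hρ : μ + ρ = k • α + l • β) {m' : ℕ} (hm : finrank K L = 6 + m)
    (hm' : finrank K L = 5 + m') :
    Iso K L (MCAlg K n6_20_1 × MCAlg K (abelian m)) ∨
      Iso K L (MCAlg K n5_5 × MCAlg K (abelian m')) := by
  have hρ' : ρ = k • α + l • β - μ := by rw [← hρ]; abel
  by_cases hli : ∀ a b c d : K, a • α + b • β + c • μ + d • ν = 0 →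
      a = 0 ∧ b = 0 ∧ c = 0 ∧ d = 0
  · left
    -- Here `dB = α ∧ (ν - kβ) - β ∧ μ`; replacing `ν` by `ν - kβ` leaves `β ∧ ν` in `dA` unchanged.
    refine iso_of_forms n6_20_1 ![α, μ, A, ν - k • β, B, -β] ?_ ?_ D h.lie_mem ?_ hm
    · intro k x y
      fin_cases k <;>
        simp [n6_20_1, h.α_lie, h.β_lie, h.μ_lie, h.ν_lie, h.lie_left, h.lie_right, wedge,
          hρ'] <;>
        ring
    · rw [Fintype.linearIndependent_iff]
      intro c hc
      simp only [Fin.sum_univ_six, Matrix.cons_val] at hc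
      obtain ⟨h2, h4⟩ := h.indep (c 2) (c 4) fun x y => by
        simpa [h.α_lie, h.β_lie, h.μ_lie, h.ν_lie] using LinearMap.congr_fun hc ⁅x, y⁆
      obtain ⟨h0, h5, h1, h3⟩ := hli (c 0) (-c 5 - c 3 * k) (c 1) (c 3) (by
        rw [← hc, h2, h4]; module)
      rw [h3, zero_mul, sub_zero, neg_eq_zero] at h5
      intro i
      fin_cases i <;> assumption
    · exact fun z hz h0 => h.eq_zero z hz (h0 2) (h0 4)
  · right
    obtain ⟨γ, hγ, ⟨m₁, m₂, m₃, hμ⟩, n₁, n₂, n₃, hν⟩ := exists_span_of_dependent h.forms hli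
    refine h.iso_n5_5 (γ := γ) ?_ hμ hν (r₁ := k - m₁) (r₂ := l - m₂) (r₃ := -m₃)
      (by rw [hρ']; nth_rewrite 1 [hμ]; module) hm'
    rcases hγ with rfl | rfl
    exacts [h.μ_lie, h.ν_lie]

end Forms

/-! ### The binary quadratic relation between `μ`, `ν` and `ρ` -/

section PencilClassification

variable {K : Type*} [Field K] {L : Type*} [LieRing L] [LieAlgebra K L]

theorem smul_add_smul_eq_transform {v₁ v₂ w₁ w₂ : K} (hδ : v₁ * w₂ - v₂ * w₁ ≠ 0) (α β : Dual K L)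
    (k l : K) : k • α + l • β =
      (k * v₁ + l * v₂) • ((v₁ * w₂ - v₂ * w₁)⁻¹ • (w₂ • α - w₁ • β)) +
      (k * w₁ + l * w₂) • ((v₁ * w₂ - v₂ * w₁)⁻¹ • (v₁ • β - v₂ • α)) := by
  ext x
  simp only [LinearMap.add_apply, LinearMap.smul_apply, LinearMap.sub_apply, smul_eq_mul]
  linear_combination -(k * α x + l * β x) * inv_mul_cancel₀ hδ

variable [FiniteDimensional K L] {D : Submodule K L} {A B α β μ ν ρ : Dual K L}

theorem IsPencil.iso_of_square (h : IsPencil D A B α β μ ν ρ) {v₁ v₂ k l : K}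
    (hv : v₁ ≠ 0 ∨ v₂ ≠ 0)
    (hrel : (v₁ * v₁) • μ + (2 * v₁ * v₂) • ν + (v₂ * v₂) • ρ = k • α + l • β) {m m' : ℕ}
    (hm : finrank K L = 6 + m) (hm' : finrank K L = 5 + m') :
    Iso K L (MCAlg K n6_19 × MCAlg K (abelian m)) ∨
      Iso K L (MCAlg K n5_5 × MCAlg K (abelian m')) := by
  obtain ⟨w₁, w₂, hδ⟩ : ∃ w₁ w₂ : K, v₁ * w₂ - v₂ * w₁ ≠ 0 := by
    rcases hv with hv | hv
    · exact ⟨0, 1, by simpa using hv⟩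
    · exact ⟨1, 0, by simpa using hv⟩
  exact (h.transform hδ).iso_n6_19_or_n5_5 (hrel.trans (smul_add_smul_eq_transform hδ α β k l))
    hm hm'

/-- The left side of `hrel` is the off-diagonal entry of the matrix in the basis `v, w`. If `v` and
`w` are proportional, they give no basis and the relation is a multiple of a square. -/
theorem IsPencil.iso_of_product (h : IsPencil D A B α β μ ν ρ) {v₁ v₂ w₁ w₂ k l : K}
    (hv : v₁ ≠ 0 ∨ v₂ ≠ 0) (hw : w₁ ≠ 0 ∨ w₂ ≠ 0)
    (hrel : (v₁ * w₁) • μ + (v₁ * w₂ + v₂ * w₁) • ν + (v₂ * w₂) • ρ = k • α + l • β) {m m' : ℕ}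
    (hm : finrank K L = 6 + m) (hm' : finrank K L = 5 + m') :
    Iso K L (MCAlg K n6_19 × MCAlg K (abelian m)) ∨
      Iso K L (MCAlg K n5_5 × MCAlg K (abelian m')) ∨
      Iso K L ((MCAlg K n3_1 × MCAlg K n3_1) × MCAlg K (abelian m)) := by
  by_cases hδ : v₁ * w₂ - v₂ * w₁ = 0
  · obtain ⟨t, ht, h1, h2⟩ : ∃ t : K, t ≠ 0 ∧ v₁ = t * w₁ ∧ v₂ = t * w₂ := by
      rcases hw with hw | hw
      · have e : v₂ = v₁ / w₁ * w₂ := by field_simp; linear_combination -hδ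
        refine ⟨v₁ / w₁, ?_, by field_simp, e⟩
        intro h0
        rw [h0, zero_mul] at e
        have : v₁ = 0 := by simpa [hw] using h0
        exact hv.elim (· this) (· e)
      · have e : v₁ = v₂ / w₂ * w₁ := by field_simp; linear_combination hδ
        refine ⟨v₂ / w₂, ?_, e, by field_simp⟩
        intro h0
        rw [h0, zero_mul] at e
        have : v₂ = 0 := by simpa [hw] using h0
        exact hv.elim (· e) (· this)
    have := h.iso_of_square (v₁ := v₁) (v₂ := v₂) (k := t * k) (l := t * l) hv (by
      have := congrArg (t • ·) hrel
      simp only [smul_add, smul_smul] at this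
      rw [← this, h1, h2]
      module) hm hm'
    tauto
  · have := (h.transform hδ).iso_n3_1_prod_or_n5_5
      (hrel.trans (smul_add_smul_eq_transform hδ α β k l)) hm hm'
    tauto

/-- The classification of pencils by the type of the quadratic form that is the relation between
`μ`, `ν` and `ρ` modulo `α` and `β`. -/
theorem IsPencil.classification [CharZero K] (hK : ∀ d : K, IsSquare d ∨ IsSquare (-d))
    (h : IsPencil D A B α β μ ν ρ) {m₇ m₆ m₅ : ℕ}
    (h7 : finrank K L = 7 + m₇) (h6 : finrank K L = 6 + m₆) (h5 : finrank K L = 5 + m₅) :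
    Iso K L (MCAlg K n7_124 × MCAlg K (abelian m₇)) ∨
      Iso K L (MCAlg K n6_19 × MCAlg K (abelian m₆)) ∨
      Iso K L (MCAlg K n5_5 × MCAlg K (abelian m₅)) ∨
      Iso K L ((MCAlg K n3_1 × MCAlg K n3_1) × MCAlg K (abelian m₆)) ∨
      (Iso K L (MCAlg K n6_20_1 × MCAlg K (abelian m₆)) ∧ ∃ d : K, ¬ IsSquare d) := by
  by_cases hli : ∀ a b c d e : K, a • α + b • β + c • μ + d • ν + e • ρ = 0 →
      a = 0 ∧ b = 0 ∧ c = 0 ∧ d = 0 ∧ e = 0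
  · exact Or.inl (h.iso_n7_124 hli h7)
  push Not at hli
  obtain ⟨a, b, c, d, e, h0, hne⟩ := hli
  have hcde : c = 0 → d = 0 → e ≠ 0 := by
    rintro rfl rfl rfl
    obtain ⟨h1, h2⟩ := h.forms a b (by rw [← h0]; module)
    exact hne h1 h2 rfl rfl rfl
  have hrel : c • μ + d • ν + e • ρ = (-a) • α + (-b) • β := by
    rw [← sub_eq_zero, ← h0]; module
  have hscale : ∀ t : K, (t * c) • μ + (t * d) • ν + (t * e) • ρ =
      (t * -a) • α + (t * -b) • β := by
    intro t
    have := congrArg (t • ·) hrel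
    simpa only [smul_add, smul_smul] using this
  by_cases hc : c = 0
  · subst hc
    have := h.iso_of_product (v₁ := 0) (v₂ := 1) (w₁ := d) (w₂ := e) (k := -a) (l := -b)
      (Or.inr one_ne_zero) (by
        by_contra! hcon
        exact hcde rfl hcon.1 hcon.2) (by rw [← hrel]; module) h6 h5
    rcases this with h | h | h
    exacts [Or.inr (Or.inl h), Or.inr (Or.inr (Or.inl h)), Or.inr (Or.inr (Or.inr (Or.inl h)))]
  have h2c : (2 * c : K) ≠ 0 := mul_ne_zero two_ne_zero hc
  by_cases hsq : IsSquare (d * d - 4 * c * e)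
  -- Completing the square, `4c(cX² + dXY + eY²) = (2cX + dY)² - s²Y²`, which factors.
  · obtain ⟨s, hs⟩ := hsq
    have := h.iso_of_product (v₁ := 2 * c) (v₂ := d - s) (w₁ := 2 * c) (w₂ := d + s)
      (k := 4 * c * -a) (l := 4 * c * -b) (Or.inl h2c) (Or.inl h2c) (by
        have e1 : 2 * c * (2 * c) = 4 * c * c := by ring
        have e2 : 2 * c * (d + s) + (d - s) * (2 * c) = 4 * c * d := by ring
        have e3 : (d - s) * (d + s) = 4 * c * e := by linear_combination hs
        rw [← hscale, e1, e2, e3]) h6 h5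
    rcases this with h | h | h
    exacts [Or.inr (Or.inl h), Or.inr (Or.inr (Or.inl h)), Or.inr (Or.inr (Or.inr (Or.inl h)))]
  · obtain ⟨s, hs⟩ := (hK (d * d - 4 * c * e)).resolve_left hsq
    have hs0 : s ≠ 0 := by
      rintro rfl
      exact hsq ⟨0, by linear_combination -hs⟩
    -- Now `4c` times the form is `(2cX + dY)² + (sY)²`, so in the basis `(2c, d), (0, s)` the
    -- relation concerns the new `μ + ρ`.
    have hδ : 2 * c * s - d * 0 ≠ 0 := by
      rw [mul_zero, sub_zero]; exact mul_ne_zero h2c hs0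
    have := (h.transform hδ).iso_n6_20_1_or_n5_5 (Eq.trans (by
        have e1 : 2 * c * (2 * c) = 4 * c * c := by ring
        have e2 : 2 * (2 * c) * d = 4 * c * d := by ring
        have e3 : d * d + s * s = 4 * c * e := by linear_combination -hs
        rw [← hscale, e1, e2, ← e3]
        module) (smul_add_smul_eq_transform hδ α β (4 * c * -a) (4 * c * -b))) h6 h5
    rcases this with h | h
    exacts [Or.inr (Or.inr (Or.inr (Or.inr ⟨h, _, hsq⟩))), Or.inr (Or.inr (Or.inl h))]

end PencilClassification

/-! ### Consequences of the rank bound -/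

section DerivedAlgebra

variable {K : Type*} [Field K]

theorem exists_dual_family {V : Type*} [AddCommGroup V] [Module K V] {n : ℕ} {v : Fin n → V}
    (hv : LinearIndependent K v) :
    ∃ f : Fin n → Dual K V, ∀ i j, f i (v j) = if i = j then 1 else 0 := by
  obtain ⟨g, hg⟩ := LinearMap.exists_leftInverse_of_injective (Fintype.linearCombination K v)
    (LinearMap.ker_eq_bot.2 (linearIndependent_iff_injective_fintypeLinearCombination.1 hv))
  refine ⟨fun i => LinearMap.proj i ∘ₗ g, fun i j => ?_⟩
  have h1 := LinearMap.congr_fun hg (Pi.single j 1)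
  rw [LinearMap.comp_apply, Fintype.linearCombination_apply_single, one_smul] at h1
  rw [LinearMap.comp_apply, h1, LinearMap.id_apply, LinearMap.proj_apply, Pi.single_apply]

variable {L : Type*} [LieRing L] [LieAlgebra K L]

variable (K L) in
/-- All operators `ad U` have rank at most 2: no three brackets `⁅U, x⁆` are linearly
independent. -/
def AdRankLeTwo : Prop := ∀ U x₁ x₂ x₃ : L, ¬ LinearIndependent K ![⁅U, x₁⁆, ⁅U, x₂⁆, ⁅U, x₃⁆]

/-- The rank bound as vanishing of 3×3 minors: a polynomial identity in `U`, so that `U` can be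
varied along a line. -/
theorem AdRankLeTwo.det_eq_zero (h : AdRankLeTwo K L) (U x₁ x₂ x₃ : L) (f g k : Dual K L) :
    f ⁅U, x₁⁆ * (g ⁅U, x₂⁆ * k ⁅U, x₃⁆ - g ⁅U, x₃⁆ * k ⁅U, x₂⁆) -
      f ⁅U, x₂⁆ * (g ⁅U, x₁⁆ * k ⁅U, x₃⁆ - g ⁅U, x₃⁆ * k ⁅U, x₁⁆) +
      f ⁅U, x₃⁆ * (g ⁅U, x₁⁆ * k ⁅U, x₂⁆ - g ⁅U, x₂⁆ * k ⁅U, x₁⁆) = 0 := by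
  have h0 := h U x₁ x₂ x₃
  rw [Fintype.not_linearIndependent_iff] at h0
  obtain ⟨c, hc, i, hi⟩ := h0
  simp only [Fin.sum_univ_three, Matrix.cons_val] at hc
  have hM : ∃ w ≠ 0, Matrix.mulVec !![f ⁅U, x₁⁆, f ⁅U, x₂⁆, f ⁅U, x₃⁆;
      g ⁅U, x₁⁆, g ⁅U, x₂⁆, g ⁅U, x₃⁆; k ⁅U, x₁⁆, k ⁅U, x₂⁆, k ⁅U, x₃⁆] w = 0 := by
    refine ⟨c, fun h => hi (congrFun h i), ?_⟩
    have key : ∀ φ : Dual K L, φ ⁅U, x₁⁆ * c 0 + φ ⁅U, x₂⁆ * c 1 + φ ⁅U, x₃⁆ * c 2 = 0 := by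
      intro φ
      have := congrArg φ hc
      simp only [map_add, map_smul, smul_eq_mul, map_zero] at this
      linear_combination this
    funext j
    fin_cases j <;> simp [Matrix.mulVec, dotProduct, Fin.sum_univ_three, key]
  have := Matrix.exists_mulVec_eq_zero_iff.1 hM
  rw [Matrix.det_fin_three] at this
  simp only [Matrix.of_apply, Matrix.cons_val] at this
  linear_combination this

theorem mem_span_pair_of_forall_dual {V : Type*} [AddCommGroup V] [Module K V] {a b r : V}
    (h : ∀ k : Dual K V, k a = 0 → k b = 0 → k r = 0) : r ∈ Submodule.span K {a, b} := by
  by_contra hr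
  obtain ⟨k, hk, hle⟩ := Submodule.exists_le_ker_of_notMem hr
  exact hk (h k (hle (Submodule.subset_span (by simp))) (hle (Submodule.subset_span (by simp))))

theorem eq_of_mem_span_pair {V : Type*} [AddCommGroup V] [Module K V] {a b r : V} {f g : Dual K V}
    (h : r ∈ Submodule.span K {a, b}) (fa : f a = 1) (fb : f b = 0) (ga : g a = 0) (gb : g b = 1) :
    r = f r • a + g r • b := by
  obtain ⟨s, t, rfl⟩ := Submodule.mem_span_pair.1 h
  simp [fa, fb, ga, gb]

theorem AdRankLeTwo.lie_mem_span (h : AdRankLeTwo K L) {U x y : L} {f g : Dual K L}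
    (hfx : f ⁅U, x⁆ = 1) (hfy : f ⁅U, y⁆ = 0) (hgx : g ⁅U, x⁆ = 0) (hgy : g ⁅U, y⁆ = 1) (z : L) :
    ⁅U, z⁆ ∈ Submodule.span K {⁅U, x⁆, ⁅U, y⁆} := by
  refine mem_span_pair_of_forall_dual fun k hx hy => ?_
  have := h.det_eq_zero U x y z f g k
  rw [hfx, hfy, hgx, hgy, hx, hy] at this
  linear_combination this

theorem AdRankLeTwo.lie_eq (h : AdRankLeTwo K L) {U x y : L} {f g : Dual K L}
    (hfx : f ⁅U, x⁆ = 1) (hfy : f ⁅U, y⁆ = 0) (hgx : g ⁅U, x⁆ = 0) (hgy : g ⁅U, y⁆ = 1) (z : L) :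
    ⁅U, z⁆ = f ⁅U, z⁆ • ⁅U, x⁆ + g ⁅U, z⁆ • ⁅U, y⁆ :=
  eq_of_mem_span_pair (h.lie_mem_span hfx hfy hgx hgy z) hfx hfy hgx hgy

theorem lie_eq_neg (x y : L) : ⁅x, y⁆ = -⁅y, x⁆ := (lie_skew x y).symm

/-- If `ad X` has the maximal rank 2, then all brackets with elements of its kernel lie in its
range. -/
theorem AdRankLeTwo.lie_mem_span_of_ker [CharZero K] (h : AdRankLeTwo K L) {X Y Z : L}
    {f g : Dual K L} (hfx : f ⁅X, Y⁆ = 1) (hfy : f ⁅X, Z⁆ = 0) (hgx : g ⁅X, Y⁆ = 0)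
    (hgy : g ⁅X, Z⁆ = 1) {w : L} (hw : ⁅X, w⁆ = 0) (u : L) :
    ⁅u, w⁆ ∈ Submodule.span K {⁅X, Y⁆, ⁅X, Z⁆} := by
  refine mem_span_pair_of_forall_dual fun k hx hy => ?_
  have key := fun t : K => h.det_eq_zero (X + t • u) Y Z w f g k
  simp only [add_lie, smul_lie, map_add, map_smul, smul_eq_mul, hw, hx, hy, hfx, hfy, hgx, hgy,
    map_zero] at key
  -- The determinant is a cubic in `t` without constant term, with linear coefficient `k ⁅u, w⁆`;
  -- these weights extract that coefficient.
  linear_combination key 1 - key (-1) / 3 - key 2 / 6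

end DerivedAlgebra

/-! ### Derived algebra of dimension three, and the pencil in dimension two -/

section TwoCases

variable {K : Type*} [Field K] [CharZero K] {L : Type*} [LieRing L] [LieAlgebra K L]

/-- A bracket is the bracket modulo `⟨⁅X, Y⁆, ⁅X, Z⁆⟩` of the components along `Y` and `Z`. -/
theorem AdRankLeTwo.lie_mem_span_triple (h : AdRankLeTwo K L) {X Y Z : L} {f g : Dual K L}
    (hfx : f ⁅X, Y⁆ = 1) (hfy : f ⁅X, Z⁆ = 0) (hgx : g ⁅X, Y⁆ = 0) (hgy : g ⁅X, Z⁆ = 1) (u v : L) :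
    ⁅u, v⁆ - (f ⁅X, u⁆ * g ⁅X, v⁆ - g ⁅X, u⁆ * f ⁅X, v⁆) • ⁅Y, Z⁆ ∈
      Submodule.span K {⁅X, Y⁆, ⁅X, Z⁆} := by
  have hker : ∀ u : L, ⁅X, u - f ⁅X, u⁆ • Y - g ⁅X, u⁆ • Z⁆ = 0 := by
    intro u
    have := h.lie_eq hfx hfy hgx hgy u
    rw [lie_sub, lie_sub, lie_smul, lie_smul, sub_sub, sub_eq_zero]
    exact this
  have h1 := h.lie_mem_span_of_ker hfx hfy hgx hgy (hker v) (f ⁅X, u⁆ • Y + g ⁅X, u⁆ • Z)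
  have h2 := h.lie_mem_span_of_ker hfx hfy hgx hgy (hker u) v
  -- Each vector is a combination of `Y` and `Z` plus an element of `ker (ad X)`; the brackets
  -- involving a kernel part lie in the span.
  have e : ⁅u, v⁆ - (f ⁅X, u⁆ * g ⁅X, v⁆ - g ⁅X, u⁆ * f ⁅X, v⁆) • ⁅Y, Z⁆ =
      ⁅f ⁅X, u⁆ • Y + g ⁅X, u⁆ • Z, v - f ⁅X, v⁆ • Y - g ⁅X, v⁆ • Z⁆ -
        ⁅v, u - f ⁅X, u⁆ • Y - g ⁅X, u⁆ • Z⁆ := by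
    simp only [lie_sub, add_lie, lie_smul, smul_lie, lie_self, lie_eq_neg v u, lie_eq_neg v Y,
      lie_eq_neg v Z, lie_eq_neg Z Y]
    module
  rw [e]
  exact Submodule.sub_mem _ h1 h2

variable [FiniteDimensional K L]

/-- The rank bound at `X`, `Y`, `Z` and `Y + Z` restricts brackets enough to correct every vector by
a combination of `X, Y, Z` to a central one. No symplectic form enters. -/
theorem iso_n6_20 (hc : ∀ x y z : L, ⁅x, ⁅y, z⁆⁆ = 0) (h : AdRankLeTwo K L) {X Y Z : L}
    (hli : LinearIndependent K ![⁅X, Y⁆, ⁅X, Z⁆, ⁅Y, Z⁆]) {m : ℕ} (hm : finrank K L = 6 + m) :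
    Iso K L (MCAlg K n6_20 × MCAlg K (abelian m)) := by
  obtain ⟨F, hF⟩ := exists_dual_family hli
  set A := F 0
  set B := F 1
  set C := F 2
  have Aa : A ⁅X, Y⁆ = 1 := hF 0 0
  have Ab : A ⁅X, Z⁆ = 0 := hF 0 1
  have Ac : A ⁅Y, Z⁆ = 0 := hF 0 2
  have Ba : B ⁅X, Y⁆ = 0 := hF 1 0
  have Bb : B ⁅X, Z⁆ = 1 := hF 1 1
  have Bc : B ⁅Y, Z⁆ = 0 := hF 1 2
  have Ca : C ⁅X, Y⁆ = 0 := hF 2 0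
  have Cb : C ⁅X, Z⁆ = 0 := hF 2 1
  have Cc : C ⁅Y, Z⁆ = 1 := hF 2 2
  clear_value A B C
  clear hF
  have neg : ∀ (φ : Dual K L) (x y : L), φ ⁅x, y⁆ = -φ ⁅y, x⁆ := fun φ x y => by
    rw [lie_eq_neg, map_neg]
  have exp : ∀ u v : L, ⁅u, v⁆ = A ⁅u, v⁆ • ⁅X, Y⁆ + B ⁅u, v⁆ • ⁅X, Z⁆ + C ⁅u, v⁆ • ⁅Y, Z⁆ := by
    intro u v
    have h1 := eq_of_mem_span_pair (h.lie_mem_span_triple Aa Ab Ba Bb u v) Aa Ab Ba Bb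
    have h2 := congrArg C h1
    simp only [map_sub, map_add, map_smul, smul_eq_mul, Ac, Bc, Ca, Cb, Cc] at h1 h2
    have h3 : C ⁅u, v⁆ = A ⁅X, u⁆ * B ⁅X, v⁆ - B ⁅X, u⁆ * A ⁅X, v⁆ := by linear_combination h2
    rw [h3]
    refine (sub_eq_iff_eq_add.1 h1).trans ?_
    module
  have zero : ∀ u v : L, A ⁅u, v⁆ = 0 → B ⁅u, v⁆ = 0 → C ⁅u, v⁆ = 0 → ⁅u, v⁆ = 0 := by
    intro u v h1 h2 h3
    rw [exp, h1, h2, h3]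
    simp
  have hX : ∀ u, C ⁅X, u⁆ = 0 := fun u => by
    rw [h.lie_eq Aa Ab Ba Bb u]
    simp [Ca, Cb]
  -- Allowing any `y` that acts like `Y` on `X` and `Z` lets `Y` be perturbed later by the
  -- corrections `r u`.
  have hY : ∀ y u, (⁅y, X⁆ = ⁅Y, X⁆) → (⁅y, Z⁆ = ⁅Y, Z⁆) → B ⁅y, u⁆ = 0 := fun y u h1 h2 => by
    rw [h.lie_eq (U := y) (x := X) (y := Z) (f := -A) (g := C)
      (by rw [h1, LinearMap.neg_apply, neg, Aa, neg_neg])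
      (by rw [h2, LinearMap.neg_apply, Ac, neg_zero])
      (by rw [h1, neg, Ca, neg_zero]) (by rw [h2, Cc]) u, h1, h2, map_add, map_smul, map_smul,
      neg B Y X, Ba, Bc]
    simp
  have hZ : ∀ z u, (⁅z, X⁆ = ⁅Z, X⁆) → (⁅z, Y⁆ = ⁅Z, Y⁆) → A ⁅z, u⁆ = 0 := fun z u h1 h2 => by
    rw [h.lie_eq (U := z) (x := X) (y := Y) (f := -B) (g := -C)
      (by rw [h1, LinearMap.neg_apply, neg, Bb, neg_neg])
      (by rw [h2, LinearMap.neg_apply, neg, Bc, neg_zero, neg_zero])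
      (by rw [h1, LinearMap.neg_apply, neg, Cb, neg_zero, neg_zero])
      (by rw [h2, LinearMap.neg_apply, neg, Cc, neg_neg]) u, h1, h2, map_add, map_smul, map_smul,
      neg A Z X, neg A Z Y, Ab, Ac]
    simp
  have hYZ : ∀ u, A ⁅Y, u⁆ = B ⁅Z, u⁆ := fun u => by
    have e1 : ⁅Y + Z, X⁆ = -⁅X, Y⁆ - ⁅X, Z⁆ := by
      rw [add_lie, lie_eq_neg Y X, lie_eq_neg Z X]; abel
    have e2 : ⁅Y + Z, Y⁆ = -⁅Y, Z⁆ := by rw [add_lie, lie_self, zero_add, lie_eq_neg]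
    have e3 := h.lie_eq (U := Y + Z) (x := X) (y := Y) (f := -A) (g := -C)
      (by rw [e1]; simp [Aa, Ab, -lie_skew]) (by rw [e2]; simp [Ac, -lie_skew]) (by rw [e1]; simp [Ca, Cb, -lie_skew]) (by rw [e2]; simp [Cc, -lie_skew]) u
    rw [e1, e2] at e3
    have e4 := congrArg A e3
    have e5 := congrArg B e3
    simp only [add_lie, map_add, map_sub, map_neg, map_smul, smul_eq_mul, Aa, Ab, Ac, Ba, Bb,
      Bc, LinearMap.neg_apply, hY Y u rfl rfl, hZ Z u rfl rfl] at e4 e5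
    linear_combination -e5
  have hN : ∀ w, ⁅X, w⁆ = 0 → ∀ u, C ⁅u, w⁆ = 0 := fun w hw u => by
    rw [eq_of_mem_span_pair (h.lie_mem_span_of_ker Aa Ab Ba Bb hw u) Aa Ab Ba Bb]
    simp [Ca, Cb]
  -- The `Y` and `Z` coefficients make `r u` commute with `X`; the `X` coefficient then cancels `A
  -- ⁅Y, u⁆`, and `hYZ` makes the same choice work for `Z`.
  set r : L → L := fun u => u + A ⁅Y, u⁆ • X - A ⁅X, u⁆ • Y - B ⁅X, u⁆ • Z with hr
  have hrX : ∀ u, ⁅X, r u⁆ = 0 := fun u => by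
    apply zero
    · simp [hr, Aa, Ab]
    · simp [hr, Ba, Bb]
    · exact hX _
  have hrY : ∀ u, ⁅Y, r u⁆ = 0 := fun u => by
    apply zero
    · simp [hr, neg A Y X, Aa, Ac]
    · exact hY _ _ rfl rfl
    · exact hN _ (hrX u) _
  have hrZ : ∀ u, ⁅Z, r u⁆ = 0 := fun u => by
    apply zero
    · exact hZ _ _ rfl rfl
    · rw [← hYZ, hrY, map_zero]
    · exact hN _ (hrX u) _
  have hr0 : ∀ u v : L, ⁅r u, v⁆ = 0 := fun u v => by
    have eX : ⁅r u, X⁆ = 0 := by rw [lie_eq_neg, hrX, neg_zero]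
    have eY : ⁅r u, Y⁆ = 0 := by rw [lie_eq_neg, hrY, neg_zero]
    have eZ : ⁅r u, Z⁆ = 0 := by rw [lie_eq_neg, hrZ, neg_zero]
    apply zero
    · have := hZ (Z + r u) v (by rw [add_lie, eX, add_zero]) (by rw [add_lie, eY, add_zero])
      rwa [add_lie, map_add, hZ Z v rfl rfl, zero_add] at this
    · have := hY (Y + r u) v (by rw [add_lie, eX, add_zero]) (by rw [add_lie, eZ, add_zero])
      rwa [add_lie, map_add, hY Y v rfl rfl, zero_add] at this
    · rw [neg, hN _ (hrX u), neg_zero]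
  have hu : ∀ u, u = r u - A ⁅Y, u⁆ • X + A ⁅X, u⁆ • Y + B ⁅X, u⁆ • Z := fun u => by
    simp only [hr]; abel
  set ξ : Dual K L := -(A ∘ₗ (LieAlgebra.ad K L Y : L →ₗ[K] L)) with hξ
  set η : Dual K L := A ∘ₗ (LieAlgebra.ad K L X : L →ₗ[K] L) with hη
  set ζ : Dual K L := B ∘ₗ (LieAlgebra.ad K L X : L →ₗ[K] L) with hζ
  have ξ_eq : ∀ u, ξ u = -A ⁅Y, u⁆ := fun u => rfl
  have η_eq : ∀ u, η u = A ⁅X, u⁆ := fun u => rfl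
  have ζ_eq : ∀ u, ζ u = B ⁅X, u⁆ := fun u => rfl
  have hlie : ∀ u v : L, ⁅u, v⁆ = wedge ξ η u v • ⁅X, Y⁆ + wedge ξ ζ u v • ⁅X, Z⁆ +
      wedge η ζ u v • ⁅Y, Z⁆ := by
    intro u v
    have hu' : u = r u + ξ u • X + η u • Y + ζ u • Z := by
      nth_rewrite 1 [hu u]
      rw [ξ_eq, η_eq, ζ_eq]
      module
    have hv' : v = r v + ξ v • X + η v • Y + ζ v • Z := by
      nth_rewrite 1 [hu v]
      rw [ξ_eq, η_eq, ζ_eq]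
      module
    have hr0' : ∀ x : L, ⁅x, r v⁆ = 0 := fun x => by rw [lie_eq_neg, hr0, neg_zero]
    have e : ⁅u, v⁆ = ⁅r u + ξ u • X + η u • Y + ζ u • Z, r v + ξ v • X + η v • Y + ζ v • Z⁆ := by
      rw [← hu', ← hv']
    rw [e]
    simp only [add_lie, lie_add, hr0, hr0', lie_smul, smul_lie, lie_self, lie_eq_neg Y X,
      lie_eq_neg Z X, lie_eq_neg Z Y, wedge]
    module
  have hA : ∀ u v, A ⁅u, v⁆ = wedge ξ η u v := fun u v => by
    rw [hlie]; simp [Aa, Ab, Ac]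
  have hB : ∀ u v, B ⁅u, v⁆ = wedge ξ ζ u v := fun u v => by
    rw [hlie]; simp [Ba, Bb, Bc]
  have hC : ∀ u v, C ⁅u, v⁆ = wedge η ζ u v := fun u v => by
    rw [hlie]; simp [Ca, Cb, Cc]
  have ξ0 : ∀ u v, ξ ⁅u, v⁆ = 0 := fun u v => by rw [ξ_eq, hc, map_zero, neg_zero]
  have η0 : ∀ u v, η ⁅u, v⁆ = 0 := fun u v => by rw [η_eq, hc, map_zero]
  have ζ0 : ∀ u v, ζ ⁅u, v⁆ = 0 := fun u v => by rw [ζ_eq, hc, map_zero]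
  refine iso_of_forms n6_20 ![ξ, η, A, ζ, B, C] ?_ ?_
    (Submodule.span K {⁅X, Y⁆, ⁅X, Z⁆, ⁅Y, Z⁆}) ?_ ?_ hm
  · intro k x y
    fin_cases k <;> simp [n6_20, ξ0, η0, ζ0, hA, hB, hC, wedge]
  · rw [Fintype.linearIndependent_iff]
    intro c hc
    simp only [Fin.sum_univ_six, Matrix.cons_val] at hc
    have h2 : c 2 = 0 := by
      simpa [ξ0, η0, ζ0, Aa, Ba, Ca] using LinearMap.congr_fun hc ⁅X, Y⁆
    have h4 : c 4 = 0 := by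
      simpa [ξ0, η0, ζ0, Ab, Bb, Cb] using LinearMap.congr_fun hc ⁅X, Z⁆
    have h5 : c 5 = 0 := by
      simpa [ξ0, η0, ζ0, Ac, Bc, Cc] using LinearMap.congr_fun hc ⁅Y, Z⁆
    have h0 : c 0 = 0 := by
      simpa [ξ_eq, η_eq, ζ_eq, h2, h4, h5, neg A Y X, Aa] using LinearMap.congr_fun hc X
    have h1 : c 1 = 0 := by
      simpa [ξ_eq, η_eq, ζ_eq, h2, h4, h5, Aa, Ba] using LinearMap.congr_fun hc Y
    have h3 : c 3 = 0 := by
      simpa [ξ_eq, η_eq, ζ_eq, h2, h4, h5, Ab, Ac, Bb] using LinearMap.congr_fun hc Z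
    intro i
    fin_cases i <;> assumption
  · intro x y
    rw [hlie x y]
    refine Submodule.add_mem _ (Submodule.add_mem _ ?_ ?_) ?_ <;>
      exact Submodule.smul_mem _ _ (Submodule.subset_span (by simp))
  · intro z hz h0
    obtain ⟨s, t, q, rfl⟩ := Submodule.mem_span_triple.1 hz
    have h2 : s = 0 := by simpa [Aa, Ab, Ac] using h0 2
    have h4 : t = 0 := by simpa [Ba, Bb, Bc] using h0 4
    have h5 : q = 0 := by simpa [Ca, Cb, Cc] using h0 5
    simp [h2, h4, h5]

omit [CharZero K] [FiniteDimensional K L] in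
/-- The symplectic form produces the pencil. -/
theorem IsSymplectic.exists_isPencil (hs : IsSymplectic K L) (hc : ∀ x y z : L, ⁅x, ⁅y, z⁆⁆ = 0)
    {X Y Z : L} {A B : Dual K L} (Aa : A ⁅X, Y⁆ = 1) (Ab : A ⁅X, Z⁆ = 0) (Ba : B ⁅X, Y⁆ = 0)
    (Bb : B ⁅X, Z⁆ = 1) (hD : ∀ u v : L, ⁅u, v⁆ ∈ Submodule.span K {⁅X, Y⁆, ⁅X, Z⁆}) :
    ∃ α β μ ν ρ, IsPencil (Submodule.span K {⁅X, Y⁆, ⁅X, Z⁆}) A B α β μ ν ρ := by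
  obtain ⟨θ, hθ⟩ := hs
  have hlie : ∀ u v : L, ⁅u, v⁆ = A ⁅u, v⁆ • ⁅X, Y⁆ + B ⁅u, v⁆ • ⁅X, Z⁆ := fun u v =>
    eq_of_mem_span_pair (hD u v) Aa Ab Ba Bb
  set α : Dual K L := θ ⁅X, Y⁆ with hα
  set β : Dual K L := θ ⁅X, Z⁆ with hβ
  have hcl : ∀ x y z : L, A ⁅x, y⁆ * α z + B ⁅x, y⁆ * β z - (A ⁅x, z⁆ * α y + B ⁅x, z⁆ * β y) +
      (A ⁅y, z⁆ * α x + B ⁅y, z⁆ * β x) = 0 := by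
    intro x y z
    have key : ∀ u v w : L, θ ⁅u, v⁆ w = A ⁅u, v⁆ * α w + B ⁅u, v⁆ * β w := fun u v w => by
      nth_rewrite 1 [hlie u v]
      simp [hα, hβ]
    rw [← key, ← key, ← key]
    exact hθ.closed x y z
  -- Nondegeneracy transfers the independence of `⁅X, Y⁆, ⁅X, Z⁆` to `α, β`.
  have hforms : ∀ s t : K, s • α + t • β = 0 → s = 0 ∧ t = 0 := by
    intro s t hst
    have h0 : s • ⁅X, Y⁆ + t • ⁅X, Z⁆ = 0 := by
      refine hθ.nondegenerate.1 _ fun y => ?_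
      have := LinearMap.congr_fun hst y
      simpa [hα, hβ] using this
    have h1 := congrArg A h0
    have h2 := congrArg B h0
    simp only [map_add, map_smul, smul_eq_mul, Aa, Ab, Ba, Bb, map_zero] at h1 h2
    exact ⟨by linear_combination h1, by linear_combination h2⟩
  have hind : LinearIndependent K ![α, β] := LinearIndependent.pair_iff.2 hforms
  obtain ⟨u, hu⟩ := exists_apply_eq_of_linearIndependent hind ![1, 0]
  obtain ⟨v, hv⟩ := exists_apply_eq_of_linearIndependent hind ![0, 1]
  have αu : α u = 1 := hu 0
  have βu : β u = 0 := hu 1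
  have αv : α v = 0 := hv 0
  have βv : β v = 1 := hv 1
  have α0 : ∀ x y : L, α ⁅x, y⁆ = 0 := fun x y => by
    have := hcl X Y ⁅x, y⁆
    simp only [hc, map_zero, Aa, Ba] at this
    linear_combination this
  have β0 : ∀ x y : L, β ⁅x, y⁆ = 0 := fun x y => by
    have := hcl X Z ⁅x, y⁆
    simp only [hc, map_zero, Ab, Bb] at this
    linear_combination this
  -- Contracting the closedness identity with `u` expresses `dA`, and with `v` expresses `dB`.
  -- Contracting with both compares `A ⁅v, ·⁆` with `B ⁅u, ·⁆`; the term `B ⁅u, v⁆ • α` absorbs the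
  -- discrepancy and makes the matrix symmetric.
  refine ⟨α, β, A ∘ₗ (LieAlgebra.ad K L u : L →ₗ[K] L), B ∘ₗ (LieAlgebra.ad K L u : L →ₗ[K] L),
    B ∘ₗ (LieAlgebra.ad K L v : L →ₗ[K] L) + B ⁅u, v⁆ • α, ⟨⟨hD, ?_, ?_⟩, ?_, ?_, α0, β0, ?_, ?_, ?_,
    hforms⟩⟩
  · intro z hz h1 h2
    rw [eq_of_mem_span_pair hz Aa Ab Ba Bb, h1, h2]
    simp
  · intro s t hst
    have h1 := hst X Y
    have h2 := hst X Z
    rw [Aa, Ba] at h1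
    rw [Ab, Bb] at h2
    exact ⟨by linear_combination h1, by linear_combination h2⟩
  · intro x y
    have := hcl u x y
    rw [αu, βu] at this
    simp only [wedge, LinearMap.comp_apply, LieAlgebra.ad_apply]
    linear_combination this
  · intro x y
    have h1 := hcl v x y
    have h2 := hcl u v x
    have h3 := hcl u v y
    rw [αv, βv] at h1 h2 h3
    rw [αu, βu] at h2 h3
    simp only [wedge, LinearMap.add_apply, LinearMap.smul_apply, smul_eq_mul,
      LinearMap.comp_apply, LieAlgebra.ad_apply]
    linear_combination h1 + α x * h3 - α y * h2
  · intro x y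
    simp [hc]
  · intro x y
    simp [hc]
  · intro x y
    simp [hc, α0]

end TwoCases

/-! ### Jordan blocks of operators of square zero -/

section JordanBlocks

variable {K : Type*} [Field K] {V : Type*} [AddCommGroup V] [Module K V]

theorem HasJordanBlocks.exists_linearIndependent {T : Module.End K V} {l : List ℕ}
    (h : HasJordanBlocks T (2 :: 2 :: l)) : ∃ y z : V, LinearIndependent K ![T y, T z] := by
  obtain ⟨-, -, e, he⟩ := h
  have h1 := he ⟨0, by simp⟩ ⟨0, by simp⟩
  have h2 := he ⟨1, by simp⟩ ⟨0, by simp⟩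
  rw [dif_pos (by simp)] at h1 h2
  refine ⟨e ⟨⟨0, by simp⟩, ⟨0, by simp⟩⟩, e ⟨⟨1, by simp⟩, ⟨0, by simp⟩⟩, ?_⟩
  rw [h1, h2]
  have := e.linearIndependent.comp ![⟨⟨0, by simp⟩, ⟨1, by simp⟩⟩, ⟨⟨1, by simp⟩, ⟨1, by simp⟩⟩] (by
    intro i j hij
    have h := congrArg (fun p : Σ i, Fin ((2 :: 2 :: l).get i) => (p.1 : ℕ)) hij
    fin_cases i <;> fin_cases j <;> simp at h ⊢)
  convert this using 1
  funext i
  fin_cases i <;> rfl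

/-- Existence of the Jordan form of an operator of square zero. -/
theorem hasJordanBlocks_of_sq_eq_zero [FiniteDimensional K V] (T : Module.End K V)
    (hT : ∀ x, T (T x) = 0) {r m : ℕ} (hr : finrank K (LinearMap.range T) = r)
    (hm : finrank K V = 2 * r + m) :
    HasJordanBlocks T (List.replicate r 2 ++ List.replicate m 1) := by
  set l := List.replicate r 2 ++ List.replicate m 1 with hl
  have hlen : l.length = r + m := by simp [hl]
  have hget : ∀ i : Fin l.length, l.get i = if (i : ℕ) < r then 2 else 1 := by
    intro i
    rw [List.get_eq_getElem]
    simp only [hl, List.getElem_append, List.length_replicate, List.getElem_replicate]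
    split_ifs <;> rfl
  have hle : LinearMap.range T ≤ LinearMap.ker T := by
    rintro _ ⟨x, rfl⟩
    exact hT x
  obtain ⟨Q, hQ⟩ := (LinearMap.range T).exists_isCompl
  -- `C` complements the range inside the kernel and supplies the blocks of size 1; preimages of a
  -- basis of the range start the blocks of size 2.
  set C := Q ⊓ LinearMap.ker T with hC
  have hsup : LinearMap.range T ⊔ C = LinearMap.ker T := by
    rw [hC, ← sup_inf_assoc_of_le _ hle, hQ.sup_eq_top, top_inf_eq]
  have hinf : LinearMap.range T ⊓ C = ⊥ := by
    rw [hC, ← inf_assoc, hQ.inf_eq_bot, bot_inf_eq]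
  have hCm : finrank K C = m := by
    have h1 := Submodule.finrank_sup_add_finrank_inf_eq (LinearMap.range T) C
    have h2 := LinearMap.finrank_range_add_finrank_ker T
    rw [hsup, hinf, finrank_bot] at h1
    omega
  let b : Basis (Fin r) K (LinearMap.range T) := finBasisOfFinrankEq K _ hr
  let c : Basis (Fin m) K C := finBasisOfFinrankEq K _ hCm
  choose v' hv' using fun i => (b i).2
  -- Indexing by `ℕ` with junk value 0 avoids casts between the index types in `e`.
  let v : ℕ → V := fun i => if h : i < r then v' ⟨i, h⟩ else 0
  let w : ℕ → V := fun i => if h : i < m then c ⟨i, h⟩ else 0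
  let e : (Σ i : Fin l.length, Fin (l.get i)) → V := fun p =>
    if (p.1 : ℕ) < r then (if (p.2 : ℕ) = 0 then v p.1 else T (v p.1)) else w (p.1 - r)
  have hTv : ∀ i : Fin r, T (v i) = b i := fun i => by simp [v, hv']
  have hw : ∀ i : Fin m, w i = c i := fun i => by simp [w]
  set S := Submodule.span K (Set.range e) with hS
  have hvS : ∀ i : Fin r, v i ∈ S := fun i => by
    refine Submodule.subset_span ⟨⟨⟨i, by omega⟩, ⟨0, ?_⟩⟩, ?_⟩
    · rw [hget]; split_ifs <;> omega
    · simp [e]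
  have hTvS : ∀ i : Fin r, T (v i) ∈ S := fun i => by
    refine Submodule.subset_span ⟨⟨⟨i, by omega⟩, ⟨1, ?_⟩⟩, ?_⟩
    · rw [hget, if_pos i.2]; omega
    · simp [e]
  have hwS : ∀ i : Fin m, w i ∈ S := fun i => by
    refine Submodule.subset_span ⟨⟨⟨r + i, by omega⟩, ⟨0, ?_⟩⟩, ?_⟩
    · rw [hget]; split_ifs <;> omega
    · simp [e]
  have hrS : LinearMap.range T ≤ S := fun x hx => by
    have : _ = x := congrArg Subtype.val (b.sum_repr ⟨x, hx⟩)
    rw [← this, Submodule.coe_sum]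
    exact Submodule.sum_mem _ fun i _ => Submodule.smul_mem _ _ (hTv i ▸ hTvS i)
  have hCS : C ≤ S := fun x hx => by
    have : _ = x := congrArg Subtype.val (c.sum_repr ⟨x, hx⟩)
    rw [← this, Submodule.coe_sum]
    exact Submodule.sum_mem _ fun i _ => Submodule.smul_mem _ _ (hw i ▸ hwS i)
  have htop : ⊤ ≤ S := fun x _ => by
    have h1 := congrArg Subtype.val (b.sum_repr ⟨T x, x, rfl⟩)
    rw [Submodule.coe_sum] at h1
    set y := ∑ i, b.repr ⟨T x, x, rfl⟩ i • v i with hy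
    have hyS : y ∈ S := Submodule.sum_mem _ fun i _ => Submodule.smul_mem _ _ (hvS i)
    have hxy : x - y ∈ LinearMap.ker T := by
      rw [LinearMap.mem_ker, map_sub, sub_eq_zero, hy, map_sum]
      refine h1.symm.trans (Finset.sum_congr rfl fun i _ => ?_)
      rw [map_smul, hTv]
      rfl
    rw [← hsup] at hxy
    have := Submodule.add_mem _ (sup_le hrS hCS hxy) hyS
    rwa [sub_add_cancel] at this
  have hcard : Fintype.card (Σ i : Fin l.length, Fin (l.get i)) = finrank K V := by
    rw [Fintype.card_sigma]
    simp only [Fintype.card_fin]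
    rw [hm, ← List.sum_ofFn, List.ofFn_get]
    simp [hl, mul_comm]
  refine ⟨?_, ?_, basisOfTopLeSpanOfCardEqFinrank e htop hcard, ?_⟩
  · rw [hl, List.pairwise_append]
    refine ⟨List.pairwise_replicate.2 (Or.inr le_rfl), List.pairwise_replicate.2 (Or.inr le_rfl), ?_⟩
    intro a ha b hb
    rw [List.eq_of_mem_replicate ha, List.eq_of_mem_replicate hb]
    omega
  · intro a ha
    rcases List.mem_append.1 ha with ha | ha <;> rw [List.eq_of_mem_replicate ha] <;> omega
  · intro i j
    rw [coe_basisOfTopLeSpanOfCardEqFinrank]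
    have hj : (j : ℕ) < if (i : ℕ) < r then 2 else 1 := (hget i) ▸ j.2
    by_cases hi : (i : ℕ) < r
    · have hi2 : l.get i = 2 := by rw [hget, if_pos hi]
      rw [if_pos hi] at hj
      by_cases hj0 : (j : ℕ) = 0
      · rw [dif_pos (by omega)]
        simp [e, hi, hj0]
      · rw [dif_neg (by omega)]
        simp [e, hi, hj0, hT]
    · have hi1 : l.get i = 1 := by rw [hget, if_neg hi]
      rw [if_neg hi] at hj
      rw [dif_neg (by omega)]
      simp only [e, if_neg hi]
      have hi' : (i : ℕ) - r < m := by have := i.2; omega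
      have : w (i - r) ∈ LinearMap.ker T := by
        rw [hw ⟨i - r, hi'⟩]
        exact (c ⟨i - r, hi'⟩).2.2
      exact this

end JordanBlocks

/-! ### The rank bound from the characteristic sequence -/

section CharacteristicSequence

variable {K : Type*} [Field K] {L : Type*} [LieRing L] [LieAlgebra K L]

theorem lie_mem_lowerCentralSeries_one (x y : L) :
    ⁅x, y⁆ ∈ LieModule.lowerCentralSeries K L L 1 := by
  rw [LieModule.lowerCentralSeries_succ]
  exact LieSubmodule.lie_mem_lie (LieSubmodule.mem_top x) (LieSubmodule.mem_top y)

theorem lie_lie_eq_zero (h : LieModule.lowerCentralSeries K L L 2 = ⊥) (x : L) {y : L}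
    (hy : y ∈ LieModule.lowerCentralSeries K L L 1) : ⁅x, y⁆ = 0 := by
  rw [← LieSubmodule.mem_bot (R := K) (L := L), ← h, LieModule.lowerCentralSeries_succ]
  exact LieSubmodule.lie_mem_lie (LieSubmodule.mem_top x) hy

theorem adRankLeTwo_of_isCharacteristicSequence [FiniteDimensional K L]
    (h2 : LieModule.lowerCentralSeries K L L 2 = ⊥) {m : ℕ}
    (h : IsCharacteristicSequence K L (2 :: 2 :: List.replicate m 1)) : AdRankLeTwo K L := by
  intro U x₁ x₂ x₃ hli
  set T := LieAlgebra.ad K L U with hT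
  have hsq : ∀ x, T (T x) = 0 := fun x => lie_lie_eq_zero h2 U (lie_mem_lowerCentralSeries_one U x)
  -- Elements of the derived algebra are central, so `U` is admissible in the maximum.
  have hU : U ∉ LieModule.lowerCentralSeries K L L 1 := by
    intro hU
    refine hli.ne_zero 0 ?_
    change ⁅U, x₁⁆ = 0
    rw [lie_eq_neg, lie_lie_eq_zero h2 x₁ hU, neg_zero]
  have hr3 : 3 ≤ finrank K (LinearMap.range T) := by
    let y : Fin 3 → LinearMap.range T := ![⟨⁅U, x₁⁆, x₁, rfl⟩, ⟨⁅U, x₂⁆, x₂, rfl⟩, ⟨⁅U, x₃⁆, x₃, rfl⟩]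
    have hy : LinearIndependent K y := by
      refine LinearIndependent.of_comp (LinearMap.range T).subtype ?_
      convert hli using 1
      funext i
      fin_cases i <;> rfl
    simpa using hy.fintype_card_le_finrank
  have hle : finrank K (LinearMap.range T) ≤ finrank K (LinearMap.ker T) :=
    Submodule.finrank_mono (by rintro _ ⟨x, rfl⟩; exact hsq x)
  have hrk := LinearMap.finrank_range_add_finrank_ker T
  obtain ⟨r, hr⟩ : ∃ r, finrank K (LinearMap.range T) = r + 3 := ⟨_, (Nat.sub_add_cancel hr3).symm⟩
  have hJ := hasJordanBlocks_of_sq_eq_zero T hsq hr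
    (m := finrank K L - 2 * (r + 3)) (by omega)
  have hlt := h.2 ⟨U, hU, hJ⟩
  refine absurd hlt (not_le.2 ?_)
  rw [List.replicate_succ, List.replicate_succ, List.replicate_succ, List.cons_append,
    List.cons_append, List.cons_append]
  refine List.Lex.cons (List.Lex.cons ?_)
  -- After the two common 2s, a third 2 is compared with the end of the list or with 1.
  cases m with
  | zero => exact List.Lex.nil
  | succ m => exact List.Lex.rel (by norm_num)

end CharacteristicSequence

/-! ### Assembly of the cases -/

section Classification

variable {K : Type*} [Field K] [CharZero K] {L : Type*} [LieRing L] [LieAlgebra K L]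

theorem classification (hK : ∀ d : K, IsSquare d ∨ IsSquare (-d)) {p : ℕ} (hp : 4 ≤ p)
    (hdim : finrank K L = 2 * p) (hs : IsSymplectic K L) (h2 : IsTwoStepNilpotent K L)
    (hcs : IsCharacteristicSequence K L (2 :: 2 :: List.replicate (2 * p - 4) 1)) :
    Iso K L (MCAlg K n7_124 × MCAlg K (abelian (2 * p - 7))) ∨
      Iso K L (MCAlg K n6_19 × MCAlg K (abelian (2 * p - 6))) ∨
      Iso K L (MCAlg K n6_20 × MCAlg K (abelian (2 * p - 6))) ∨
      Iso K L (MCAlg K n5_5 × MCAlg K (abelian (2 * p - 5))) ∨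
      Iso K L ((MCAlg K n3_1 × MCAlg K n3_1) × MCAlg K (abelian (2 * p - 6))) ∨
      (Iso K L (MCAlg K n6_20_1 × MCAlg K (abelian (2 * p - 6))) ∧ ∃ d : K, ¬ IsSquare d) := by
  have : FiniteDimensional K L := FiniteDimensional.of_finrank_pos (by omega)
  have hc : ∀ x y z : L, ⁅x, ⁅y, z⁆⁆ = 0 := fun x y z =>
    lie_lie_eq_zero h2.1 x (lie_mem_lowerCentralSeries_one y z)
  have hrank := adRankLeTwo_of_isCharacteristicSequence h2.1 hcs
  obtain ⟨⟨X, -, hX⟩, -⟩ := hcs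
  obtain ⟨Y, Z, hYZ⟩ := hX.exists_linearIndependent
  rw [LieAlgebra.ad_apply, LieAlgebra.ad_apply] at hYZ
  obtain ⟨F, hF⟩ := exists_dual_family hYZ
  have Aa : F 0 ⁅X, Y⁆ = 1 := hF 0 0
  have Ab : F 0 ⁅X, Z⁆ = 0 := hF 0 1
  have Ba : F 1 ⁅X, Y⁆ = 0 := hF 1 0
  have Bb : F 1 ⁅X, Z⁆ = 1 := hF 1 1
  -- This decides whether the derived algebra has dimension 2 or 3.
  by_cases hmem : ⁅Y, Z⁆ ∈ Submodule.span K {⁅X, Y⁆, ⁅X, Z⁆}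
  · obtain ⟨α, β, μ, ν, ρ, hP⟩ := hs.exists_isPencil hc Aa Ab Ba Bb fun u v => by
      have h1 := hrank.lie_mem_span_triple Aa Ab Ba Bb u v
      have h2 := Submodule.add_mem _ h1 (Submodule.smul_mem _
        (F 0 ⁅X, u⁆ * F 1 ⁅X, v⁆ - F 1 ⁅X, u⁆ * F 0 ⁅X, v⁆) hmem)
      rwa [sub_add_cancel] at h2
    rcases hP.classification hK (m₇ := 2 * p - 7) (m₆ := 2 * p - 6) (m₅ := 2 * p - 5)
      (by omega) (by omega) (by omega) with h | h | h | h | h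
    exacts [Or.inl h, Or.inr (Or.inl h), Or.inr (Or.inr (Or.inr (Or.inl h))),
      Or.inr (Or.inr (Or.inr (Or.inr (Or.inl h)))), Or.inr (Or.inr (Or.inr (Or.inr (Or.inr h))))]
  · refine Or.inr (Or.inr (Or.inl (iso_n6_20 hc hrank (X := X) (Y := Y) (Z := Z) ?_ (by omega))))
    obtain ⟨C, hC, hle⟩ := Submodule.exists_le_ker_of_notMem hmem
    have Ca : C ⁅X, Y⁆ = 0 := hle (Submodule.subset_span (by simp))
    have Cb : C ⁅X, Z⁆ = 0 := hle (Submodule.subset_span (by simp))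
    rw [Fintype.linearIndependent_iff]
    intro c h0
    simp only [Fin.sum_univ_three, Matrix.cons_val] at h0
    have c2 : c 2 = 0 := by simpa [Ca, Cb, hC] using congrArg C h0
    have c0 : c 0 = 0 := by simpa [Aa, Ab, c2] using congrArg (F 0) h0
    have c1 : c 1 = 0 := by simpa [Ba, Bb, c2] using congrArg (F 1) h0
    intro i
    fin_cases i <;> assumption

end Classification

end SymplecticTwoStep

open SymplecticTwoStep in
theorem mainTheorem3 (p : ℕ) (hp : 4 ≤ p) :
    (∀ (g : Type*) [LieRing g] [LieAlgebra ℂ g],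
      Module.finrank ℂ g = 2 * p → IsSymplectic ℂ g → IsTwoStepNilpotent ℂ g →
      IsCharacteristicSequence ℂ g (2 :: 2 :: List.replicate (2 * p - 4) 1) →
      IsDecomposable ℂ g ∧
        (Iso ℂ g (MCAlg ℂ n7_124 × MCAlg ℂ (abelian (2 * p - 7))) ∨
         Iso ℂ g (MCAlg ℂ n6_19 × MCAlg ℂ (abelian (2 * p - 6))) ∨
         Iso ℂ g (MCAlg ℂ n6_20 × MCAlg ℂ (abelian (2 * p - 6))) ∨
         Iso ℂ g (MCAlg ℂ n5_5 × MCAlg ℂ (abelian (2 * p - 5))) ∨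
         Iso ℂ g ((MCAlg ℂ n3_1 × MCAlg ℂ n3_1) × MCAlg ℂ (abelian (2 * p - 6))))) ∧
    (∀ (g : Type*) [LieRing g] [LieAlgebra ℝ g],
      Module.finrank ℝ g = 2 * p → IsSymplectic ℝ g → IsTwoStepNilpotent ℝ g →
      IsCharacteristicSequence ℝ g (2 :: 2 :: List.replicate (2 * p - 4) 1) →
      IsDecomposable ℝ g ∧
        (Iso ℝ g (MCAlg ℝ n7_124 × MCAlg ℝ (abelian (2 * p - 7))) ∨
         Iso ℝ g (MCAlg ℝ n6_19 × MCAlg ℝ (abelian (2 * p - 6))) ∨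
         Iso ℝ g (MCAlg ℝ n6_20 × MCAlg ℝ (abelian (2 * p - 6))) ∨
         Iso ℝ g (MCAlg ℝ n5_5 × MCAlg ℝ (abelian (2 * p - 5))) ∨
         Iso ℝ g ((MCAlg ℝ n3_1 × MCAlg ℝ n3_1) × MCAlg ℝ (abelian (2 * p - 6))) ∨
         Iso ℝ g (MCAlg ℝ n6_20_1 × MCAlg ℝ (abelian (2 * p - 6))))) := by
  have h5 : 0 < 2 * p - 5 := by omega
  have h6 : 0 < 2 * p - 6 := by omega
  have h7 : 0 < 2 * p - 7 := by omega
  constructor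
  · intro g _ _ hdim hs h2 hcs
    have hiso := classification (fun d : ℂ => Or.inl (IsAlgClosed.exists_eq_mul_self d)) hp hdim hs h2 hcs
    rcases hiso with h | h | h | h | h | ⟨-, d, hd⟩
    · exact ⟨isDecomposable_of_iso h7 h, Or.inl h⟩
    · exact ⟨isDecomposable_of_iso h6 h, Or.inr (Or.inl h)⟩
    · exact ⟨isDecomposable_of_iso h6 h, Or.inr (Or.inr (Or.inl h))⟩
    · exact ⟨isDecomposable_of_iso h5 h, Or.inr (Or.inr (Or.inr (Or.inl h)))⟩
    · exact ⟨isDecomposable_of_iso h6 h, Or.inr (Or.inr (Or.inr (Or.inr h)))⟩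
    · exact absurd (IsAlgClosed.exists_eq_mul_self d) hd
  · intro g _ _ hdim hs h2 hcs
    -- Over the reals the anisotropic case occurs, but only as a sum of two squares up to a scalar;
    -- over `ℂ` it is excluded by square roots.
    have hsq : ∀ d : ℝ, IsSquare d ∨ IsSquare (-d) := fun d => by
      rw [Real.isSquare_iff, Real.isSquare_iff, Left.nonneg_neg_iff]
      exact le_total 0 d
    have hiso := classification hsq hp hdim hs h2 hcs
    rcases hiso with h | h | h | h | h | ⟨h, -⟩
    · exact ⟨isDecomposable_of_iso h7 h, Or.inl h⟩
    · exact ⟨isDecomposable_of_iso h6 h, Or.inr (Or.inl h)⟩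
    · exact ⟨isDecomposable_of_iso h6 h, Or.inr (Or.inr (Or.inl h))⟩
    · exact ⟨isDecomposable_of_iso h5 h, Or.inr (Or.inr (Or.inr (Or.inl h)))⟩
    · exact ⟨isDecomposable_of_iso h6 h, Or.inr (Or.inr (Or.inr (Or.inr (Or.inl h))))⟩
    · exact ⟨isDecomposable_of_iso h6 h, Or.inr (Or.inr (Or.inr (Or.inr (Or.inr h))))⟩
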